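/- Let $\Bbbk$ be an algebraically closed field of characteristic $0$. Let $\mathcal C$ be a slightly degenerate braided pivotal fusion category over $\Bbbk$. This means: $\mathcal C$ is a $\Bbbk$-linear abelian semisimple rigid monoidal category with bilinear tensor product, finite-dimensional spaces of morphisms, finitely many simple objects up to isomorphism and simple unit $\mathbf 1$; it has a braiding $c_{X,Y}\colon X\otimes Y\to Y\otimes X$ and a pivotal structure, i.e. an isomorphism of monoidal functors $a_X\colon X\to X^{**}$; and its symmetric center (the full subcategory of the objects $X$ with $c_{Y,X}\circ c_{X,Y}=\mathrm{id}$ for all $Y$) is equivalent, as a $\Bbbk$-linear braided monoidal category, to the category $\mathrm{sVect}$ of finite-dimensional superspaces with braiding $v\otimes w\mapsto(-1)^{|v||w|}w\otimes v$. Here $X^*$ is the dual of $X$ with $\mathrm{ev}_X\colon X^*\otimes X\to\mathbf 1$ and $\mathrm{coev}_X\colon\mathbf 1\to X\otimes X^*$, and $u_X\colon X\to X^{**}$ is the Drinfeld morphism $(\mathrm{ev}_X\otimes\mathrm{id})\circ(c_{X,X^*}\otimes\mathrm{id})\circ(\mathrm{id}\otimes\mathrm{coev}_{X^*})$. Let $\varepsilon$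 be the non-unit simple object of the symmetric center, and fix an isomorphism $\xi\colon\varepsilon\otimes\varepsilon\to\mathbf 1$. (Associativity and unit isomorphisms are suppressed below.) Let $\hat{\mathcal C}$ have the objects of $\mathcal C$ and the superspaces of morphisms $\mathrm{Hom}_{\hat{\mathcal C}}(X,Y)_0=\mathrm{Hom}_{\mathcal C}(X,Y)$, $\mathrm{Hom}_{\hat{\mathcal C}}(X,Y)_1=\mathrm{Hom}_{\mathcal C}(X,\varepsilon\otimes Y)$. The composite of odd $f\colon X\to\varepsilon\otimes Y$ and odd $g\colon Y\to\varepsilon\otimes Z$ is $(\xi\otimes\mathrm{id}_Z)\circ(\mathrm{id}_\varepsilon\otimes g)\circ f$; the other composites of homogeneous morphisms are the evident ones ($g\circ f$ if $f$ is even, $(\mathrm{id}_\varepsilon\otimes g)\circ f$ if $f$ is odd and $g$ is even). The tensor product of objects is that of $\mathcal C$, and for homogeneous $f\in\mathrm{Hom}_{\hat{\mathcal C}}(X,Y)$ and $f'\in\mathrm{Hom}_{\hat{\mathcal C}}(X',Y')$ the morphism $f\,\hat\otimes\,f'$ is $f\otimes f'$ if $f'$ is even, $(c_{Y,\varepsilon}\otimes\mathrm{id}_{Y'})\circ(f\otimes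 f')$ if $f$ is even and $f'$ is odd, and $(-\xi\otimes\mathrm{id}_{Y\otimes Y'})\circ(\mathrm{id}_\varepsilon\otimes c_{Y,\varepsilon}\otimes\mathrm{id}_{Y'})\circ(f\otimes f')$ if both are odd. The unit, the associativity and unit constraints, the braiding, and the duals with their evaluations and coevaluations are those of $\mathcal C$, regarded as even morphisms. Then $\hat{\mathcal C}$ is a rigid monoidal supercategory (in particular $(g\hat\otimes g')\circ(f\hat\otimes f')=(-1)^{|g'||f|}(g\circ f)\hat\otimes(g'\circ f')$ for homogeneous morphisms), and the morphisms $c_{X,Y}$ are a braiding on it: they are even isomorphisms that satisfy the hexagon axioms and $c_{X',Y'}\circ(f\hat\otimes g)=(-1)^{|f||g|}(g\hat\otimes f)\circ c_{X,Y}$ for homogeneous $f\colon X\to X'$, $g\colon Y\to Y'$. Moreover: 1. If $a_\varepsilon=u_\varepsilon$, then the morphisms $a_X$, regarded as even morphisms of $\hat{\mathcal C}$, form a pivotal structure on $\hat{\mathcal C}$: an even monoidal supernatural isomorphism from the identity to the superfunctor $X\mapsto X^{**}$, $f\mapsto f^{**}$. 2. If $a_\varepsilon=-u_\varepsilon$,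 then they form a superpivotal structure on $\hat{\mathcal C}$: an even monoidal supernatural isomorphism from the identity to the superfunctor $X\mapsto X^{**}$, $f\mapsto(-1)^{|f|}f^{**}$. -/

import Mathlib

open CategoryTheory MonoidalCategory
open scoped TensorProduct

universe w

/-- A finite-dimensional superspace: a vector space with a decomposition into an even and an
odd subspace. -/
structure SVect (k : Type w) [Field k] where
  carrier : Type w
  [addCommGroup : AddCommGroup carrier]
  [module : Module k carrier]
  [finite : Module.Finite k carrier]
  even : Submodule k carrier
  odd : Submodule k carrier
  isCompl : IsCompl even odd

namespace SVect

attribute [instance] SVect.addCommGroup SVect.module SVect.finite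

variable {k : Type w} [Field k]

/-- The linear maps which preserve the parity. -/
def evenMaps (V W : SVect k) : Submodule k (V.carrier →ₗ[k] W.carrier) where
  carrier := {f | (∀ v ∈ V.even, f v ∈ W.even) ∧ (∀ v ∈ V.odd, f v ∈ W.odd)}
  add_mem' := fun ha hb =>
    ⟨fun v hv => W.even.add_mem (ha.1 v hv) (hb.1 v hv),
      fun v hv => W.odd.add_mem (ha.2 v hv) (hb.2 v hv)⟩
  zero_mem' := ⟨fun _ _ => W.even.zero_mem, fun _ _ => W.odd.zero_mem⟩
  smul_mem' := fun c _ ha =>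
    ⟨fun v hv => W.even.smul_mem c (ha.1 v hv), fun v hv => W.odd.smul_mem c (ha.2 v hv)⟩

instance : Category (SVect k) where
  Hom V W := evenMaps V W
  id V := ⟨LinearMap.id, fun _ h => h, fun _ h => h⟩
  comp f g := ⟨g.1 ∘ₗ f.1, fun v h => g.2.1 _ (f.2.1 v h), fun v h => g.2.2 _ (f.2.2 v h)⟩

theorem hom_ext {V W : SVect k} {f g : V ⟶ W} (h : f.1 = g.1) : f = g := Subtype.ext h

@[simp] theorem id_val (V : SVect k) : (𝟙 V : V ⟶ V).1 = LinearMap.id := rfl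

@[simp] theorem comp_val {U V W : SVect k} (f : U ⟶ V) (g : V ⟶ W) :
    (f ≫ g).1 = g.1 ∘ₗ f.1 := rfl

instance : Preadditive (SVect k) where
  homGroup V W := inferInstanceAs (AddCommGroup (evenMaps V W))
  add_comp _ _ _ f f' g := hom_ext (LinearMap.comp_add f.1 f'.1 g.1)
  comp_add _ _ _ f g g' := hom_ext (LinearMap.add_comp f.1 g'.1 g.1)

instance : Linear k (SVect k) where
  homModule V W := inferInstanceAs (Module k (evenMaps V W))
  smul_comp _ _ _ r f g := hom_ext (LinearMap.comp_smul g.1 r f.1)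
  comp_smul _ _ _ f r g := hom_ext (LinearMap.smul_comp r g.1 f.1)

/-- The projection onto the odd part along the even part. -/
noncomputable def oddProj (V : SVect k) : V.carrier →ₗ[k] V.carrier :=
  V.odd.projection V.even V.isCompl.symm

theorem oddProj_eq_zero_iff {V : SVect k} {v : V.carrier} :
    V.oddProj v = 0 ↔ v ∈ V.even :=
  Submodule.projection_apply_eq_zero_iff _

theorem oddProj_eq_self_iff {V : SVect k} {v : V.carrier} :
    V.oddProj v = v ↔ v ∈ V.odd :=
  ⟨fun h => h ▸ Submodule.projection_apply_mem _ v,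
    fun h => Submodule.projection_apply_of_mem_left _ h⟩

@[simp] theorem oddProj_oddProj {V : SVect k} (v : V.carrier) :
    V.oddProj (V.oddProj v) = V.oddProj v :=
  oddProj_eq_self_iff.2 (Submodule.projection_apply_mem _ v)

theorem oddProj_unique {V : SVect k} (Q : V.carrier →ₗ[k] V.carrier)
    (h0 : ∀ v ∈ V.even, Q v = 0) (h1 : ∀ v ∈ V.odd, Q v = v) : V.oddProj = Q := by
  ext v
  obtain ⟨a, ha, b, hb, rfl⟩ := Submodule.mem_sup.1
    (V.isCompl.sup_eq_top ▸ Submodule.mem_top : v ∈ V.even ⊔ V.odd)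
  rw [map_add, map_add, h0 a ha, h1 b hb, oddProj_eq_zero_iff.2 ha, oddProj_eq_self_iff.2 hb]

theorem mem_evenMaps_iff {V W : SVect k} {f : V.carrier →ₗ[k] W.carrier} :
    f ∈ evenMaps V W ↔ W.oddProj ∘ₗ f = f ∘ₗ V.oddProj := by
  constructor
  · rintro ⟨h0, h1⟩
    ext v
    obtain ⟨a, ha, b, hb, rfl⟩ := Submodule.mem_sup.1
      (V.isCompl.sup_eq_top ▸ Submodule.mem_top : v ∈ V.even ⊔ V.odd)
    simp [oddProj_eq_zero_iff.2 ha, oddProj_eq_self_iff.2 hb,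
      oddProj_eq_zero_iff.2 (h0 a ha), oddProj_eq_self_iff.2 (h1 b hb)]
  · intro h
    have h' : ∀ v, W.oddProj (f v) = f (V.oddProj v) := fun v => LinearMap.congr_fun h v
    refine ⟨fun v hv => ?_, fun v hv => ?_⟩
    · rw [← oddProj_eq_zero_iff, h', oddProj_eq_zero_iff.2 hv, map_zero]
    · rw [← oddProj_eq_self_iff, h', oddProj_eq_self_iff.2 hv]

theorem hom_oddProj {V W : SVect k} (f : V ⟶ W) (v : V.carrier) :
    W.oddProj (f.1 v) = f.1 (V.oddProj v) :=
  LinearMap.congr_fun (mem_evenMaps_iff.1 f.2) v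

/-- `π₀ ⊗ π₁ + π₁ ⊗ π₀`, for the projections `π₀`, `π₁` to the even and to the odd part. -/
noncomputable def tensorOdd (V W : SVect k) :
    V.carrier ⊗[k] W.carrier →ₗ[k] V.carrier ⊗[k] W.carrier :=
  TensorProduct.map (LinearMap.id - V.oddProj) W.oddProj +
    TensorProduct.map V.oddProj (LinearMap.id - W.oddProj)

/-- The even part `V₀ ⊗ W₀ ⊕ V₁ ⊗ W₁` of the tensor product. -/
def tensorEven (V W : SVect k) : Submodule k (V.carrier ⊗[k] W.carrier) :=
  Submodule.map₂ (TensorProduct.mk k _ _) V.even W.even ⊔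
    Submodule.map₂ (TensorProduct.mk k _ _) V.odd W.odd

/-- The odd part `V₀ ⊗ W₁ ⊕ V₁ ⊗ W₀` of the tensor product. -/
def tensorOddPart (V W : SVect k) : Submodule k (V.carrier ⊗[k] W.carrier) :=
  Submodule.map₂ (TensorProduct.mk k _ _) V.even W.odd ⊔
    Submodule.map₂ (TensorProduct.mk k _ _) V.odd W.even

theorem tensorOdd_of_even {V W : SVect k} {x : V.carrier ⊗[k] W.carrier}
    (hx : x ∈ tensorEven V W) : tensorOdd V W x = 0 := by
  have : tensorEven V W ≤ LinearMap.ker (tensorOdd V W) := by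
    refine sup_le (Submodule.map₂_le.2 fun v hv w hw => ?_)
      (Submodule.map₂_le.2 fun v hv w hw => ?_)
    · simp [tensorOdd, oddProj_eq_zero_iff.2 hv, oddProj_eq_zero_iff.2 hw]
    · simp [tensorOdd, oddProj_eq_self_iff.2 hv, oddProj_eq_self_iff.2 hw]
  exact this hx

theorem tensorOdd_of_odd {V W : SVect k} {x : V.carrier ⊗[k] W.carrier}
    (hx : x ∈ tensorOddPart V W) : tensorOdd V W x = x := by
  have : tensorOddPart V W ≤ LinearMap.ker (tensorOdd V W - LinearMap.id) := by
    refine sup_le (Submodule.map₂_le.2 fun v hv w hw => ?_)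
      (Submodule.map₂_le.2 fun v hv w hw => ?_)
    · simp [tensorOdd, oddProj_eq_zero_iff.2 hv, oddProj_eq_self_iff.2 hw]
    · simp [tensorOdd, oddProj_eq_self_iff.2 hv, oddProj_eq_zero_iff.2 hw]
  simpa [sub_eq_zero] using this hx

theorem tensor_isCompl (V W : SVect k) :
    IsCompl (tensorEven V W) (tensorOddPart V W) := by
  constructor
  · rw [Submodule.disjoint_def]
    intro x h0 h1
    rw [← tensorOdd_of_odd h1, tensorOdd_of_even h0]
  · rw [codisjoint_iff, eq_top_iff]
    have key : ∀ (v : V.carrier) (w : W.carrier),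
        v ⊗ₜ[k] w ∈ tensorEven V W ⊔ tensorOddPart V W := by
      intro v w
      obtain ⟨a, ha, b, hb, rfl⟩ := Submodule.mem_sup.1
        (V.isCompl.sup_eq_top ▸ Submodule.mem_top : v ∈ V.even ⊔ V.odd)
      obtain ⟨c, hc, d, hd, rfl⟩ := Submodule.mem_sup.1
        (W.isCompl.sup_eq_top ▸ Submodule.mem_top : w ∈ W.even ⊔ W.odd)
      have h00 : a ⊗ₜ[k] c ∈ tensorEven V W :=
        Submodule.mem_sup_left (Submodule.apply_mem_map₂ _ ha hc)
      have h11 : b ⊗ₜ[k] d ∈ tensorEven V W :=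
        Submodule.mem_sup_right (Submodule.apply_mem_map₂ _ hb hd)
      have h01 : a ⊗ₜ[k] d ∈ tensorOddPart V W :=
        Submodule.mem_sup_left (Submodule.apply_mem_map₂ _ ha hd)
      have h10 : b ⊗ₜ[k] c ∈ tensorOddPart V W :=
        Submodule.mem_sup_right (Submodule.apply_mem_map₂ _ hb hc)
      rw [TensorProduct.add_tmul, TensorProduct.tmul_add, TensorProduct.tmul_add]
      exact add_mem (add_mem (Submodule.mem_sup_left h00) (Submodule.mem_sup_right h01))
        (add_mem (Submodule.mem_sup_right h10) (Submodule.mem_sup_left h11))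
    intro x _
    induction x using TensorProduct.induction_on with
    | zero => exact zero_mem _
    | tmul v w => exact key v w
    | add x y hx hy => exact add_mem (hx trivial) (hy trivial)

/-- The tensor product of superspaces. -/
abbrev tensor (V W : SVect k) : SVect k where
  carrier := V.carrier ⊗[k] W.carrier
  even := tensorEven V W
  odd := tensorOddPart V W
  isCompl := tensor_isCompl V W

theorem oddProj_tensor (V W : SVect k) : (tensor V W).oddProj = tensorOdd V W :=
  oddProj_unique _ (fun _ h => tensorOdd_of_even h) (fun _ h => tensorOdd_of_odd h)

theorem oddProj_tmul {V W : SVect k} (v : V.carrier) (w : W.carrier) :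
    (tensor V W).oddProj (v ⊗ₜ[k] w) =
      (v - V.oddProj v) ⊗ₜ[k] W.oddProj w + V.oddProj v ⊗ₜ[k] (w - W.oddProj w) := by
  rw [oddProj_tensor]
  rfl

/-- The unit superspace `k`, purely even. -/
abbrev unit (k : Type w) [Field k] : SVect k where
  carrier := k
  even := ⊤
  odd := ⊥
  isCompl := isCompl_top_bot

theorem oddProj_unit (c : k) : (unit k).oddProj c = (0 : k) :=
  oddProj_eq_zero_iff.2 (show c ∈ (⊤ : Submodule k k) from Submodule.mem_top)

/-- A parity-preserving linear equivalence is an isomorphism of superspaces. -/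
def mkIso {V W : SVect k} (e : V.carrier ≃ₗ[k] W.carrier)
    (h : ∀ v, W.oddProj (e v) = e (V.oddProj v)) : V ≅ W where
  hom := ⟨e.toLinearMap, mem_evenMaps_iff.2 (LinearMap.ext h)⟩
  inv := ⟨e.symm.toLinearMap, mem_evenMaps_iff.2 (LinearMap.ext fun w => by
    apply e.injective
    simp [← h])⟩
  hom_inv_id := hom_ext (by ext v; simp)
  inv_hom_id := hom_ext (by ext v; simp)

@[simp] theorem mkIso_hom_val {V W : SVect k} (e : V.carrier ≃ₗ[k] W.carrier)
    (h : ∀ v, W.oddProj (e v) = e (V.oddProj v)) : (mkIso e h).hom.1 = e.toLinearMap := rfl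

@[simp] theorem mkIso_inv_val {V W : SVect k} (e : V.carrier ≃ₗ[k] W.carrier)
    (h : ∀ v, W.oddProj (e v) = e (V.oddProj v)) : (mkIso e h).inv.1 = e.symm.toLinearMap := rfl

/-- The tensor product of two parity-preserving maps. -/
noncomputable def tensorMap {V V' W W' : SVect k} (f : V ⟶ V') (g : W ⟶ W') :
    tensor V W ⟶ tensor V' W' :=
  ⟨TensorProduct.map f.1 g.1, mem_evenMaps_iff.2 (by
    refine TensorProduct.ext' fun v w => ?_
    rw [LinearMap.comp_apply, LinearMap.comp_apply, TensorProduct.map_tmul, oddProj_tmul,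
      oddProj_tmul]
    simp [hom_oddProj])⟩

@[simp] theorem tensorMap_val {V V' W W' : SVect k} (f : V ⟶ V') (g : W ⟶ W') :
    (tensorMap f g).1 = TensorProduct.map f.1 g.1 := rfl

theorem oddProj_assoc (U V W : SVect k) :
    (tensor U (tensor V W)).oddProj ∘ₗ
        (TensorProduct.assoc k U.carrier V.carrier W.carrier).toLinearMap =
      (TensorProduct.assoc k U.carrier V.carrier W.carrier).toLinearMap ∘ₗ
        (tensor (tensor U V) W).oddProj := by
  refine TensorProduct.ext_threefold fun u v w => ?_
  simp only [LinearMap.comp_apply, LinearEquiv.coe_coe, TensorProduct.assoc_tmul]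
  rw [oddProj_tmul (V := tensor U V), oddProj_tmul (W := tensor V W), oddProj_tmul, oddProj_tmul]
  simp only [TensorProduct.add_tmul, TensorProduct.tmul_add, TensorProduct.sub_tmul,
    TensorProduct.tmul_sub, map_add, map_sub, TensorProduct.assoc_tmul]
  abel

theorem oddProj_unit_tmul {V : SVect k} (c : k) (v : V.carrier) :
    (tensor (unit k) V).oddProj (c ⊗ₜ[k] v) = c ⊗ₜ[k] V.oddProj v := by
  have key : ∀ d : k, d = 0 → (c - d) ⊗ₜ[k] V.oddProj v + d ⊗ₜ[k] (v - V.oddProj v) =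
      c ⊗ₜ[k] V.oddProj v := by
    rintro _ rfl
    simp
  exact (oddProj_tmul (V := unit k) c v).trans (key _ (oddProj_unit c))

theorem oddProj_tmul_unit {V : SVect k} (v : V.carrier) (c : k) :
    (tensor V (unit k)).oddProj (v ⊗ₜ[k] c) = V.oddProj v ⊗ₜ[k] c := by
  have key : ∀ d : k, d = 0 → (v - V.oddProj v) ⊗ₜ[k] d + V.oddProj v ⊗ₜ[k] (c - d) =
      V.oddProj v ⊗ₜ[k] c := by
    rintro _ rfl
    simp
  exact (oddProj_tmul (W := unit k) v c).trans (key _ (oddProj_unit c))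

noncomputable instance : MonoidalCategoryStruct (SVect k) where
  tensorObj := tensor
  whiskerLeft V _ _ f := tensorMap (𝟙 V) f
  whiskerRight f W := tensorMap f (𝟙 W)
  tensorHom := tensorMap
  tensorUnit := unit k
  associator U V W := mkIso (TensorProduct.assoc k U.carrier V.carrier W.carrier)
    (LinearMap.congr_fun (oddProj_assoc U V W))
  leftUnitor V := mkIso (TensorProduct.lid k V.carrier) (LinearMap.congr_fun
    (f := V.oddProj ∘ₗ (TensorProduct.lid k V.carrier).toLinearMap)
    (g := (TensorProduct.lid k V.carrier).toLinearMap ∘ₗ (tensor (unit k) V).oddProj) (by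
      refine TensorProduct.ext' fun c v => ?_
      exact (V.oddProj.map_smul c v).trans
        (congrArg (TensorProduct.lid k V.carrier) (oddProj_unit_tmul c v)).symm))
  rightUnitor V := mkIso (TensorProduct.rid k V.carrier) (LinearMap.congr_fun
    (f := V.oddProj ∘ₗ (TensorProduct.rid k V.carrier).toLinearMap)
    (g := (TensorProduct.rid k V.carrier).toLinearMap ∘ₗ (tensor V (unit k)).oddProj) (by
      refine TensorProduct.ext' fun v c => ?_
      exact (V.oddProj.map_smul c v).trans
        (congrArg (TensorProduct.rid k V.carrier) (oddProj_tmul_unit v c)).symm))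

noncomputable instance : MonoidalCategory (SVect k) where
  tensorHom_def _ _ := hom_ext (TensorProduct.ext' fun _ _ => rfl)
  id_tensorHom_id _ _ := hom_ext (TensorProduct.ext' fun _ _ => rfl)
  tensorHom_comp_tensorHom _ _ _ _ := hom_ext (TensorProduct.ext' fun _ _ => rfl)
  whiskerLeft_id _ _ := hom_ext (TensorProduct.ext' fun _ _ => rfl)
  id_whiskerRight _ _ := hom_ext (TensorProduct.ext' fun _ _ => rfl)
  associator_naturality _ _ _ := hom_ext (TensorProduct.ext_threefold fun _ _ _ => rfl)
  leftUnitor_naturality f := hom_ext (TensorProduct.ext' fun c v => (f.1.map_smul c v).symm)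
  rightUnitor_naturality f := hom_ext (TensorProduct.ext' fun v c => (f.1.map_smul c v).symm)
  pentagon _ _ _ _ := hom_ext (TensorProduct.ext_fourfold fun _ _ _ _ => rfl)
  triangle _ _ := hom_ext (TensorProduct.ext_threefold fun v c w =>
    (TensorProduct.smul_tmul c v w).symm)

/-- The linear map `v ⊗ w ↦ (-1)^(|v||w|) w ⊗ v`, for homogeneous `v` and `w`. -/
noncomputable def swapMap (V W : SVect k) :
    V.carrier ⊗[k] W.carrier →ₗ[k] W.carrier ⊗[k] V.carrier :=
  (TensorProduct.comm k V.carrier W.carrier).toLinearMap ∘ₗ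
    (LinearMap.id - (2 : k) • TensorProduct.map V.oddProj W.oddProj)

@[simp] theorem swapMap_tmul {V W : SVect k} (v : V.carrier) (w : W.carrier) :
    swapMap V W (v ⊗ₜ[k] w) = w ⊗ₜ[k] v - (2 : k) • (W.oddProj w ⊗ₜ[k] V.oddProj v) := by
  simp [swapMap]

theorem swapMap_of_even_left {V W : SVect k} {v : V.carrier} (hv : v ∈ V.even)
    (w : W.carrier) : swapMap V W (v ⊗ₜ[k] w) = w ⊗ₜ[k] v := by
  simp [oddProj_eq_zero_iff.2 hv]

theorem swapMap_of_even_right {V W : SVect k} (v : V.carrier) {w : W.carrier}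
    (hw : w ∈ W.even) : swapMap V W (v ⊗ₜ[k] w) = w ⊗ₜ[k] v := by
  simp [oddProj_eq_zero_iff.2 hw]

theorem swapMap_of_odd {V W : SVect k} {v : V.carrier} {w : W.carrier} (hv : v ∈ V.odd)
    (hw : w ∈ W.odd) : swapMap V W (v ⊗ₜ[k] w) = -(w ⊗ₜ[k] v) := by
  rw [swapMap_tmul, oddProj_eq_self_iff.2 hv, oddProj_eq_self_iff.2 hw, two_smul]
  abel

theorem swapMap_swapMap (V W : SVect k) : swapMap W V ∘ₗ swapMap V W = LinearMap.id := by
  refine TensorProduct.ext' fun v w => ?_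
  simp only [LinearMap.comp_apply, swapMap_tmul, map_sub, map_smul, oddProj_oddProj,
    LinearMap.id_apply]
  module

theorem oddProj_swapMap (V W : SVect k) :
    (tensor W V).oddProj ∘ₗ swapMap V W = swapMap V W ∘ₗ (tensor V W).oddProj := by
  refine TensorProduct.ext' fun v w => ?_
  rw [LinearMap.comp_apply, LinearMap.comp_apply, swapMap_tmul, oddProj_tmul, map_sub, map_smul,
    oddProj_tmul, oddProj_tmul]
  simp only [map_add, swapMap_tmul, map_sub, oddProj_oddProj, sub_self, TensorProduct.zero_tmul,
    TensorProduct.tmul_zero, TensorProduct.sub_tmul, TensorProduct.tmul_sub]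
  module

/-- The braiding `v ⊗ w ↦ (-1)^(|v||w|) w ⊗ v` of superspaces. -/
noncomputable instance : BraidedCategory (SVect k) where
  braiding V W := mkIso (V := tensor V W) (W := tensor W V)
    (LinearEquiv.ofLinearMap (swapMap V W) (swapMap W V) (swapMap_swapMap W V) (swapMap_swapMap V W))
    (LinearMap.congr_fun (oddProj_swapMap V W))
  braiding_naturality_right V _ _ f := hom_ext (TensorProduct.ext' fun v w => by
    change swapMap _ _ (v ⊗ₜ[k] f.1 w) = TensorProduct.map f.1 LinearMap.id (swapMap _ _ (v ⊗ₜ w))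
    simp [hom_oddProj])
  braiding_naturality_left f Z := hom_ext (TensorProduct.ext' fun v w => by
    change swapMap _ _ (f.1 v ⊗ₜ[k] w) = TensorProduct.map LinearMap.id f.1 (swapMap _ _ (v ⊗ₜ w))
    simp [hom_oddProj])
  hexagon_forward U V W := hom_ext (TensorProduct.ext_threefold fun u v w => by
    change TensorProduct.assoc k _ _ _ (swapMap U (tensor V W) (u ⊗ₜ (v ⊗ₜ w))) =
      TensorProduct.map LinearMap.id (swapMap U W)
        (TensorProduct.assoc k _ _ _ (swapMap U V (u ⊗ₜ v) ⊗ₜ w))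
    rw [swapMap_tmul (W := tensor V W), oddProj_tmul]
    simp only [swapMap_tmul, map_add, map_sub, map_smul, oddProj_oddProj,
      TensorProduct.sub_tmul, TensorProduct.tmul_sub, TensorProduct.add_tmul,
      TensorProduct.assoc_tmul, TensorProduct.map_tmul, LinearMap.id_apply,
      ← TensorProduct.smul_tmul', TensorProduct.tmul_smul]
    module)
  hexagon_reverse U V W := hom_ext (TensorProduct.ext_threefold' fun u v w => by
    change (TensorProduct.assoc k _ _ _).symm (swapMap (tensor U V) W ((u ⊗ₜ v) ⊗ₜ w)) =
      TensorProduct.map (swapMap U W) LinearMap.id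
        ((TensorProduct.assoc k _ _ _).symm (u ⊗ₜ swapMap V W (v ⊗ₜ w)))
    rw [swapMap_tmul (V := tensor U V), oddProj_tmul]
    simp only [swapMap_tmul, map_add, map_sub, map_smul, oddProj_oddProj,
      TensorProduct.sub_tmul, TensorProduct.tmul_sub, TensorProduct.tmul_add,
      TensorProduct.assoc_symm_tmul, TensorProduct.map_tmul, LinearMap.id_apply,
      ← TensorProduct.smul_tmul', TensorProduct.tmul_smul]
    module)

end SVect

universe v u

section BraidedFusion

open Limits HasRightDual

attribute [local instance] Abelian.hasFiniteBiproducts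

variable {C : Type u} [Category.{v} C] [MonoidalCategory C]

/-- A fusion category: a `k`-linear abelian rigid monoidal category with bilinear tensor product
(these are the type class arguments) which is semisimple, with finitely many simple objects up to
isomorphism, finite-dimensional spaces of morphisms and a simple unit object. -/
structure IsFusionCategory (k : Type w) [Field k] (C : Type u) [Category.{v} C] [Abelian C]
    [Linear k C] [MonoidalCategory C] [MonoidalPreadditive C] [MonoidalLinear k C]
    [RigidCategory C] : Prop where
  finite_hom : ∀ X Y : C, Module.Finite k (X ⟶ Y)
  semisimple : ∀ X : C, ∃ (n : ℕ) (S : Fin n → C), (∀ i, Simple (S i)) ∧ Nonempty (X ≅ ⨁ S)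
  finite_simple : ∃ (n : ℕ) (S : Fin n → C), (∀ i, Simple (S i)) ∧
    ∀ X : C, Simple X → ∃ i, Nonempty (X ≅ S i)
  simple_unit : Simple (𝟙_ C)

/-- The objects `X` with `c_{Y,X} ∘ c_{X,Y} = id` for all `Y`. -/
def symmetricCenter (C : Type u) [Category.{v} C] [MonoidalCategory C] [BraidedCategory C] :
    ObjectProperty C :=
  fun X => ∀ Y : C, (β_ X Y).hom ≫ (β_ Y X).hom = 𝟙 (X ⊗ Y)

instance [BraidedCategory C] : (symmetricCenter C).IsMonoidal where
  prop_unit Y := by simp [braiding_tensorUnit_left, braiding_tensorUnit_right]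
  prop_tensor X₁ X₂ h₁ h₂ Y := by
    have h₁' := h₁ Y
    have h₂' := h₂ Y
    simp only [BraidedCategory.braiding_tensor_left_hom, BraidedCategory.braiding_tensor_right_hom,
      Category.assoc, Iso.hom_inv_id_assoc]
    rw [← comp_whiskerRight_assoc, h₁', id_whiskerRight, Category.id_comp,
      Iso.inv_hom_id_assoc, ← MonoidalCategory.whiskerLeft_comp_assoc, h₂']
    simp

/-- A braided category is slightly degenerate if its symmetric center is equivalent, as a
`k`-linear braided monoidal category, to the category of finite-dimensional superspaces. -/
def IsSlightlyDegenerate (k : Type w) [Field k] (C : Type u) [Category.{v} C] [Preadditive C]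
    [Linear k C] [MonoidalCategory C] [BraidedCategory C] : Prop :=
  ∃ F : (symmetricCenter C).FullSubcategory ⥤ SVect k,
    F.IsEquivalence ∧ F.Additive ∧ F.Linear k ∧ Nonempty F.Braided

variable [RightRigidCategory C]

/-- The canonical isomorphism `Y* ⊗ X* ≅ (X ⊗ Y)*`. Here and below `X*`, with evaluation
`X* ⊗ X ⟶ 𝟙` and coevaluation `𝟙 ⟶ X ⊗ X*`, is Mathlib's `rightDual X`, and `f*` is Mathlib's
`rightAdjointMate f`. -/
def tensorDualIso (X Y : C) : rightDual Y ⊗ rightDual X ≅ rightDual (X ⊗ Y) :=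
  rightDualIso (X := X ⊗ Y) ExactPairing.tensor HasRightDual.exact

/-- The canonical morphism `X** ⊗ Y** ⟶ (X ⊗ Y)**`. -/
def tensorDoubleDual (X Y : C) :
    rightDual (rightDual X) ⊗ rightDual (rightDual Y) ⟶ rightDual (rightDual (X ⊗ Y)) :=
  (tensorDualIso (rightDual Y) (rightDual X)).hom ≫ rightAdjointMate (tensorDualIso X Y).inv

/-- A pivotal structure: an isomorphism of monoidal functors `X ⟶ X**`. -/
structure PivotalStructure (C : Type u) [Category.{v} C] [MonoidalCategory C]
    [RightRigidCategory C] where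
  iso : ∀ X : C, X ≅ rightDual (rightDual X)
  naturality : ∀ {X Y : C} (f : X ⟶ Y),
    f ≫ (iso Y).hom = (iso X).hom ≫ rightAdjointMate (rightAdjointMate f)
  tensor : ∀ X Y : C,
    (iso (X ⊗ Y)).hom = ((iso X).hom ⊗ₘ (iso Y).hom) ≫ tensorDoubleDual X Y

/-- The Drinfeld morphism `X ⟶ X ⊗ X* ⊗ X** ⟶ X* ⊗ X ⊗ X** ⟶ X**`. -/
def drinfeld [BraidedCategory C] (X : C) : X ⟶ rightDual (rightDual X) :=
  (ρ_ X).inv ≫ X ◁ η_ (rightDual X) (rightDual (rightDual X)) ≫ (α_ _ _ _).inv ≫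
    (β_ X (rightDual X)).hom ▷ rightDual (rightDual X) ≫
    ε_ X (rightDual X) ▷ rightDual (rightDual X) ≫ (λ_ _).hom

end BraidedFusion

/-! ### Supercategories

The operations are collected in a structure, and the axioms are predicates on it. -/

/-- The operations of a monoidal supercategory: spaces of morphisms with their homogeneous
subspaces, composition (in diagrammatic order), and the tensor product with its constraints. -/
structure SuperOps (k : Type w) [Field k] (Obj : Type u) where
  Hom : Obj → Obj → Type v
  [addCommGroup : ∀ X Y, AddCommGroup (Hom X Y)]
  [module : ∀ X Y, Module k (Hom X Y)]
  parity : ∀ X Y, ZMod 2 → Submodule k (Hom X Y)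
  id : ∀ X, Hom X X
  comp : ∀ {X Y Z}, Hom X Y → Hom Y Z → Hom X Z
  unit : Obj
  tensorObj : Obj → Obj → Obj
  tensorHom : ∀ {X Y X' Y'}, Hom X Y → Hom X' Y' → Hom (tensorObj X X') (tensorObj Y Y')
  assoc : ∀ X Y Z, Hom (tensorObj (tensorObj X Y) Z) (tensorObj X (tensorObj Y Z))
  assocInv : ∀ X Y Z, Hom (tensorObj X (tensorObj Y Z)) (tensorObj (tensorObj X Y) Z)
  left : ∀ X, Hom (tensorObj unit X) X
  leftInv : ∀ X, Hom X (tensorObj unit X)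
  right : ∀ X, Hom (tensorObj X unit) X
  rightInv : ∀ X, Hom X (tensorObj X unit)

namespace SuperOps

attribute [instance] SuperOps.addCommGroup SuperOps.module

variable {k : Type w} [Field k] {Obj : Type u} (D : SuperOps.{w, v, u} k Obj)


/-- The sign `(-1)^(ij)`. -/
def sign (k : Type w) [Field k] (i j : ZMod 2) : k := (-1) ^ (i.val * j.val)

/-- The axioms of a supercategory, that is, of a category enriched in finite-dimensional
superspaces. -/
structure IsSupercategory : Prop where
  finite : ∀ X Y, Module.Finite k (D.Hom X Y)
  isInternal : ∀ X Y, DirectSum.IsInternal (D.parity X Y)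
  id_mem : ∀ X, D.id X ∈ D.parity X X 0
  comp_mem : ∀ {X Y Z} (i j : ZMod 2) (f : D.Hom X Y) (g : D.Hom Y Z),
    f ∈ D.parity X Y i → g ∈ D.parity Y Z j → D.comp f g ∈ D.parity X Z (i + j)
  add_comp : ∀ {X Y Z} (f f' : D.Hom X Y) (g : D.Hom Y Z),
    D.comp (f + f') g = D.comp f g + D.comp f' g
  comp_add : ∀ {X Y Z} (f : D.Hom X Y) (g g' : D.Hom Y Z),
    D.comp f (g + g') = D.comp f g + D.comp f g'
  smul_comp : ∀ {X Y Z} (c : k) (f : D.Hom X Y) (g : D.Hom Y Z),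
    D.comp (c • f) g = c • D.comp f g
  comp_smul : ∀ {X Y Z} (c : k) (f : D.Hom X Y) (g : D.Hom Y Z),
    D.comp f (c • g) = c • D.comp f g
  id_comp : ∀ {X Y} (f : D.Hom X Y), D.comp (D.id X) f = f
  comp_id : ∀ {X Y} (f : D.Hom X Y), D.comp f (D.id Y) = f
  assoc : ∀ {W X Y Z} (f : D.Hom W X) (g : D.Hom X Y) (h : D.Hom Y Z),
    D.comp (D.comp f g) h = D.comp f (D.comp g h)

/-- `f` is even and `g` is an even inverse of `f`. -/
structure IsEvenInverse {X Y : Obj} (f : D.Hom X Y) (g : D.Hom Y X) : Prop where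
  hom_mem : f ∈ D.parity X Y 0
  inv_mem : g ∈ D.parity Y X 0
  hom_inv : D.comp f g = D.id X
  inv_hom : D.comp g f = D.id Y

/-- The axioms of a monoidal supercategory: the tensor product is a superfunctor
`D ⊠ D → D` (which includes the superinterchange law), the constraints are even supernatural
isomorphisms, and the pentagon and the triangle commute. -/
structure IsMonoidalSupercategory : Prop extends D.IsSupercategory where
  tensor_mem : ∀ {X Y X' Y'} (i j : ZMod 2) (f : D.Hom X Y) (f' : D.Hom X' Y'),
    f ∈ D.parity X Y i → f' ∈ D.parity X' Y' j →
      D.tensorHom f f' ∈ D.parity (D.tensorObj X X') (D.tensorObj Y Y') (i + j)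
  add_tensor : ∀ {X Y X' Y'} (f g : D.Hom X Y) (f' : D.Hom X' Y'),
    D.tensorHom (f + g) f' = D.tensorHom f f' + D.tensorHom g f'
  tensor_add : ∀ {X Y X' Y'} (f : D.Hom X Y) (f' g' : D.Hom X' Y'),
    D.tensorHom f (f' + g') = D.tensorHom f f' + D.tensorHom f g'
  smul_tensor : ∀ {X Y X' Y'} (c : k) (f : D.Hom X Y) (f' : D.Hom X' Y'),
    D.tensorHom (c • f) f' = c • D.tensorHom f f'
  tensor_smul : ∀ {X Y X' Y'} (c : k) (f : D.Hom X Y) (f' : D.Hom X' Y'),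
    D.tensorHom f (c • f') = c • D.tensorHom f f'
  tensor_id : ∀ X Y, D.tensorHom (D.id X) (D.id Y) = D.id (D.tensorObj X Y)
  /-- `(g ⊗ g') ∘ (f ⊗ f') = (-1)^(|g'||f|) (g ∘ f) ⊗ (g' ∘ f')` -/
  superinterchange : ∀ {X Y Z X' Y' Z'} (i i' j j' : ZMod 2) (f : D.Hom X Y) (f' : D.Hom X' Y')
    (g : D.Hom Y Z) (g' : D.Hom Y' Z'),
    f ∈ D.parity X Y i → f' ∈ D.parity X' Y' i' → g ∈ D.parity Y Z j → g' ∈ D.parity Y' Z' j' →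
      D.comp (D.tensorHom f f') (D.tensorHom g g') =
        sign k j' i • D.tensorHom (D.comp f g) (D.comp f' g')
  assoc_iso : ∀ X Y Z, D.IsEvenInverse (D.assoc X Y Z) (D.assocInv X Y Z)
  left_iso : ∀ X, D.IsEvenInverse (D.left X) (D.leftInv X)
  right_iso : ∀ X, D.IsEvenInverse (D.right X) (D.rightInv X)
  assoc_naturality : ∀ {X Y Z X' Y' Z'} (f : D.Hom X X') (g : D.Hom Y Y') (h : D.Hom Z Z'),
    D.comp (D.tensorHom (D.tensorHom f g) h) (D.assoc X' Y' Z') =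
      D.comp (D.assoc X Y Z) (D.tensorHom f (D.tensorHom g h))
  left_naturality : ∀ {X Y} (f : D.Hom X Y),
    D.comp (D.tensorHom (D.id D.unit) f) (D.left Y) = D.comp (D.left X) f
  right_naturality : ∀ {X Y} (f : D.Hom X Y),
    D.comp (D.tensorHom f (D.id D.unit)) (D.right Y) = D.comp (D.right X) f
  pentagon : ∀ W X Y Z,
    D.comp (D.tensorHom (D.assoc W X Y) (D.id Z))
        (D.comp (D.assoc W (D.tensorObj X Y) Z) (D.tensorHom (D.id W) (D.assoc X Y Z))) =
      D.comp (D.assoc (D.tensorObj W X) Y Z) (D.assoc W X (D.tensorObj Y Z))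
  triangle : ∀ X Y,
    D.comp (D.assoc X D.unit Y) (D.tensorHom (D.id X) (D.left Y)) =
      D.tensorHom (D.right X) (D.id Y)

/-- The axioms of a braiding: an even supernatural isomorphism from `X ⊗ Y` to the superfunctor
`(X, Y) ↦ Y ⊗ X`, `f ⊗ g ↦ (-1)^(|f||g|) g ⊗ f`, which satisfies the hexagon axioms. -/
structure IsBraiding (c : ∀ X Y, D.Hom (D.tensorObj X Y) (D.tensorObj Y X)) : Prop where
  iso : ∀ X Y, ∃ d, D.IsEvenInverse (c X Y) d
  naturality : ∀ {X Y X' Y'} (i j : ZMod 2) (f : D.Hom X X') (g : D.Hom Y Y'),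
    f ∈ D.parity X X' i → g ∈ D.parity Y Y' j →
      D.comp (D.tensorHom f g) (c X' Y') = sign k i j • D.comp (c X Y) (D.tensorHom g f)
  hexagon_forward : ∀ X Y Z,
    D.comp (D.assoc X Y Z) (D.comp (c X (D.tensorObj Y Z)) (D.assoc Y Z X)) =
      D.comp (D.tensorHom (c X Y) (D.id Z))
        (D.comp (D.assoc Y X Z) (D.tensorHom (D.id Y) (c X Z)))
  hexagon_reverse : ∀ X Y Z,
    D.comp (D.assocInv X Y Z) (D.comp (c (D.tensorObj X Y) Z) (D.assocInv Z X Y)) =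
      D.comp (D.tensorHom (D.id X) (c Y Z))
        (D.comp (D.assocInv X Z Y) (D.tensorHom (c X Z) (D.id Y)))

/-- `Y` is a left dual of `X` (equivalently, `X` is a right dual of `Y`), with evaluation `ev`
and coevaluation `coev`. -/
structure IsDualPair (X Y : Obj) (ev : D.Hom (D.tensorObj Y X) D.unit)
    (coev : D.Hom D.unit (D.tensorObj X Y)) : Prop where
  ev_mem : ev ∈ D.parity _ _ 0
  coev_mem : coev ∈ D.parity _ _ 0
  zigzag : D.comp (D.leftInv X) (D.comp (D.tensorHom coev (D.id X))
    (D.comp (D.assoc X Y X) (D.comp (D.tensorHom (D.id X) ev) (D.right X)))) = D.id X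
  zigzag' : D.comp (D.rightInv Y) (D.comp (D.tensorHom (D.id Y) coev)
    (D.comp (D.assocInv Y X Y) (D.comp (D.tensorHom ev (D.id Y)) (D.left Y)))) = D.id Y

/-- A choice of left dual objects `X*`, evaluations `X* ⊗ X ⟶ 𝟙` and coevaluations
`𝟙 ⟶ X ⊗ X*`. -/
structure DualOps (D : SuperOps.{w, v, u} k Obj) where
  dual : Obj → Obj
  ev : ∀ X, D.Hom (D.tensorObj (dual X) X) D.unit
  coev : ∀ X, D.Hom D.unit (D.tensorObj X (dual X))

/-- Rigidity: the chosen left duals are left duals, and every object has a right dual. -/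
structure IsRigid (R : DualOps D) : Prop where
  left_dual : ∀ X, D.IsDualPair X (R.dual X) (R.ev X) (R.coev X)
  right_dual : ∀ X, ∃ Y ev coev, D.IsDualPair Y X ev coev

variable {D}

/-- For `ev : Y' ⊗ Y ⟶ 𝟙`, `coev : 𝟙 ⟶ X ⊗ X'` and `f : X ⟶ Y`, the composition
`Y' ⟶ Y' ⊗ X ⊗ X' ⟶ Y' ⊗ Y ⊗ X' ⟶ X'`. -/
def mate {X X' Y Y' : Obj} (ev : D.Hom (D.tensorObj Y' Y) D.unit)
    (coev : D.Hom D.unit (D.tensorObj X X')) (f : D.Hom X Y) : D.Hom Y' X' :=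
  D.comp (D.rightInv Y') (D.comp (D.tensorHom (D.id Y') coev)
    (D.comp (D.tensorHom (D.id Y') (D.tensorHom f (D.id X')))
      (D.comp (D.assocInv Y' Y X') (D.comp (D.tensorHom ev (D.id X')) (D.left X')))))

namespace DualOps

variable (R : DualOps D)

/-- The dual `f* : Y* ⟶ X*` of `f : X ⟶ Y`. -/
def map {X Y : Obj} (f : D.Hom X Y) : D.Hom (R.dual Y) (R.dual X) :=
  mate (R.ev Y) (R.coev X) f

/-- The evaluation `(Y* ⊗ X*) ⊗ (X ⊗ Y) ⟶ Y* ⊗ Y ⟶ 𝟙`. -/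
def evTensor (X Y : Obj) :
    D.Hom (D.tensorObj (D.tensorObj (R.dual Y) (R.dual X)) (D.tensorObj X Y)) D.unit :=
  D.comp (D.assoc (R.dual Y) (R.dual X) (D.tensorObj X Y))
    (D.comp (D.tensorHom (D.id (R.dual Y)) (D.comp (D.assocInv (R.dual X) X Y)
      (D.comp (D.tensorHom (R.ev X) (D.id Y)) (D.left Y)))) (R.ev Y))

/-- The coevaluation `𝟙 ⟶ X ⊗ X* ⟶ (X ⊗ Y) ⊗ (Y* ⊗ X*)`. -/
def coevTensor (X Y : Obj) :
    D.Hom D.unit (D.tensorObj (D.tensorObj X Y) (D.tensorObj (R.dual Y) (R.dual X))) :=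
  D.comp (R.coev X) (D.comp (D.tensorHom (D.id X) (D.comp (D.leftInv (R.dual X))
    (D.comp (D.tensorHom (R.coev Y) (D.id (R.dual X))) (D.assoc Y (R.dual Y) (R.dual X)))))
      (D.assocInv X Y (D.tensorObj (R.dual Y) (R.dual X))))

/-- The canonical isomorphism `Y* ⊗ X* ⟶ (X ⊗ Y)*`. -/
def tensorDual (X Y : Obj) :
    D.Hom (D.tensorObj (R.dual Y) (R.dual X)) (R.dual (D.tensorObj X Y)) :=
  mate (R.evTensor X Y) (R.coev (D.tensorObj X Y)) (D.id (D.tensorObj X Y))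

/-- The inverse `(X ⊗ Y)* ⟶ Y* ⊗ X*` of the canonical isomorphism. -/
def tensorDualInv (X Y : Obj) :
    D.Hom (R.dual (D.tensorObj X Y)) (D.tensorObj (R.dual Y) (R.dual X)) :=
  mate (R.ev (D.tensorObj X Y)) (R.coevTensor X Y) (D.id (D.tensorObj X Y))

/-- The canonical isomorphism `X** ⊗ Y** ⟶ (X ⊗ Y)**`. -/
def tensorDoubleDual (X Y : Obj) :
    D.Hom (D.tensorObj (R.dual (R.dual X)) (R.dual (R.dual Y)))
      (R.dual (R.dual (D.tensorObj X Y))) :=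
  D.comp (R.tensorDual (R.dual Y) (R.dual X)) (R.map (R.tensorDualInv X Y))

/-- An even monoidal supernatural isomorphism from the identity to the superfunctor
`X ↦ X**`, `f ↦ (-1)^(s|f|) f**`. -/
structure IsTwistedPivotal (s : ZMod 2)
    (a : ∀ X : Obj, D.Hom X (R.dual (R.dual X))) : Prop where
  iso : ∀ X, ∃ b, D.IsEvenInverse (a X) b
  naturality : ∀ {X Y} (i : ZMod 2) (f : D.Hom X Y), f ∈ D.parity X Y i →
    D.comp f (a Y) = D.comp (a X) (sign k s i • R.map (R.map f))
  tensor : ∀ X Y, a (D.tensorObj X Y) =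
    D.comp (D.tensorHom (a X) (a Y)) (R.tensorDoubleDual X Y)

/-- A pivotal structure: an even monoidal supernatural isomorphism from the identity to
`f ↦ f**`. -/
def IsPivotal (a : ∀ X : Obj, D.Hom X (R.dual (R.dual X))) : Prop := R.IsTwistedPivotal 0 a

/-- A superpivotal structure: an even monoidal supernatural isomorphism from the identity to
`f ↦ (-1)^|f| f**`. -/
def IsSuperpivotal (a : ∀ X : Obj, D.Hom X (R.dual (R.dual X))) : Prop :=
  R.IsTwistedPivotal 1 a

end DualOps

end SuperOps

/-! ### The supercategory `Ĉ` -/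

section Hat

variable {C : Type u} [Category.{v} C] [MonoidalCategory C]

/-- `ξ ⊗ id : e ⊗ (e ⊗ Z) ⟶ Z`. -/
def cancelPair {e : C} (ξ : e ⊗ e ≅ 𝟙_ C) (Z : C) : e ⊗ (e ⊗ Z) ⟶ Z :=
  (α_ e e Z).inv ≫ ξ.hom ▷ Z ≫ (λ_ Z).hom

/-- `c_{Y,e} ⊗ id : Y ⊗ (e ⊗ Y') ⟶ e ⊗ (Y ⊗ Y')`. -/
def slide [BraidedCategory C] (e Y Y' : C) : Y ⊗ (e ⊗ Y') ⟶ e ⊗ (Y ⊗ Y') :=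
  (α_ Y e Y').inv ≫ (β_ Y e).hom ▷ Y' ≫ (α_ e Y Y').hom

variable [Preadditive C]

/-- The category with the objects of `C` and the superspaces of morphisms
`Hom(X, Y) ⊕ Hom(X, e ⊗ Y)`: a pair `(f₀, f₁)` has the even part `f₀` and the odd part `f₁`. -/
def hat (k : Type w) [Field k] [Linear k C] [BraidedCategory C] (e : C) (ξ : e ⊗ e ≅ 𝟙_ C) :
    SuperOps.{w, v, u} k C where
  Hom X Y := (X ⟶ Y) × (X ⟶ e ⊗ Y)
  parity _ _ i := if i = 0 then Submodule.prod ⊤ ⊥ else Submodule.prod ⊥ ⊤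
  id X := (𝟙 X, 0)
  comp {_ _ Z} f g :=
    (f.1 ≫ g.1 + f.2 ≫ e ◁ g.2 ≫ cancelPair ξ Z, f.1 ≫ g.2 + f.2 ≫ e ◁ g.1)
  unit := 𝟙_ C
  tensorObj X Y := X ⊗ Y
  tensorHom {_ Y _ Y'} f f' :=
    ((f.1 ⊗ₘ f'.1) -
        (f.2 ⊗ₘ f'.2) ≫ (α_ e Y (e ⊗ Y')).hom ≫ e ◁ slide e Y Y' ≫ cancelPair ξ (Y ⊗ Y'),
      (f.1 ⊗ₘ f'.2) ≫ slide e Y Y' + (f.2 ⊗ₘ f'.1) ≫ (α_ e Y Y').hom)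
  assoc X Y Z := ((α_ X Y Z).hom, 0)
  assocInv X Y Z := ((α_ X Y Z).inv, 0)
  left X := ((λ_ X).hom, 0)
  leftInv X := ((λ_ X).inv, 0)
  right X := ((ρ_ X).hom, 0)
  rightInv X := ((ρ_ X).inv, 0)

variable (k : Type w) [Field k] [Linear k C] [BraidedCategory C] (e : C) (ξ : e ⊗ e ≅ 𝟙_ C)

/-- A morphism of `C` as an even morphism of `Ĉ`. -/
def hatEven {X Y : C} (f : X ⟶ Y) : (hat k e ξ).Hom X Y := ((f, 0) : (X ⟶ Y) × (X ⟶ e ⊗ Y))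

/-- The duals, evaluations and coevaluations of `C`, in `Ĉ`. -/
def hatDual [RightRigidCategory C] : (hat k e ξ).DualOps where
  dual X := HasRightDual.rightDual X
  ev X := hatEven k e ξ (ε_ X (HasRightDual.rightDual X))
  coev X := hatEven k e ξ (η_ X (HasRightDual.rightDual X))

end Hat

/-!
# The supercategory of a slightly degenerate braided pivotal fusion category

Everything is a computation with the endofunctor `e ⊗ -` of `C`, which carries the contraction
`cancelPair ξ Z : e ⊗ (e ⊗ Z) ⟶ Z` and two ways of entering a tensor product, the associator
`(e ⊗ Y) ⊗ Z ⟶ e ⊗ (Y ⊗ Z)` and the braiding `slide e Y Z : Y ⊗ (e ⊗ Z) ⟶ e ⊗ (Y ⊗ Z)`. Only two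
facts about `e` matter: it is transparent, and its self-braiding is `-1`. The latter is
`IsSlightlyDegenerate.braiding_self`: an equivalence from the symmetric center to superspaces
sends `e` to a superspace whose square is the unit, hence to a line, and this line is odd because
`e` is not the unit.

The sign of the self-braiding appears twice when `e` moves past a pair `e ⊗ e`, so that composition
is associative (`cancelPair_comm`), and once when two factors `e` enter a tensor product in the
other order (`slide_whisker_anticomm`), which is the sign in the superinterchange law. Since every
`f ⊗ f'` is the composite of the two whiskerings `id ⊗ f'` and `f ⊗ id` (`HatHom.tensor_def`), the
superinterchange law and the naturality of the associator and of the braiding follow from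
statements about a single whiskered morphism.

For the pivotal structures, the dual of an odd morphism `f : X ⟶ e ⊗ Y` is
`oddMate f : Y* ⟶ e ⊗ X*`. The main point is `rightAdjointMate_rightAdjointMate`: the double dual of
`f`, taken in `C`, factors as
`X** ⟶ e ⊗ Y** ⟶ e** ⊗ Y** ⟶ (e ⊗ Y)**`,
with `oddMate (oddMate f)`, the Drinfeld morphism of `e`, and the monoidal constraint of the double
dual. It is proved by pairing both sides with `Y* ⊗ e*`; transparency of `e` allows all crossings
with `e` to be undone. As the pivotal structure `a` is natural and monoidal in `C`, comparing
its component at `e ⊗ Y`, which is `a_e ⊗ a_Y` followed by that constraint, with this factorization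
shows that `a` is natural for `f` up to the scalar by which `a_e` differs from the Drinfeld
morphism.
-/

/-! ### The functor `e ⊗ -` -/

section OddEndofunctor

variable {C : Type u} [Category.{v} C] [MonoidalCategory C]

theorem cancelPair_naturality {e : C} (ξ : e ⊗ e ≅ 𝟙_ C) {Z Z' : C} (f : Z ⟶ Z') :
    e ◁ e ◁ f ≫ cancelPair ξ Z' = cancelPair ξ Z ≫ f := by
  simp only [cancelPair, Category.assoc]
  rw [associator_inv_naturality_right_assoc, whisker_exchange_assoc, leftUnitor_naturality]

theorem cancelPair_whiskerRight {e : C} (ξ : e ⊗ e ≅ 𝟙_ C) (Y Z : C) :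
    (α_ e (e ⊗ Y) Z).hom ≫ e ◁ (α_ e Y Z).hom ≫ cancelPair ξ (Y ⊗ Z) = cancelPair ξ Y ▷ Z := by
  simp only [cancelPair]
  monoidal

section

variable [Preadditive C] [MonoidalPreadditive C]

theorem whiskerLeft_neg (X : C) {Y Z : C} (f : Y ⟶ Z) : X ◁ (-f) = -(X ◁ f) :=
  (tensorLeft X).map_neg

theorem neg_whiskerRight {Y Z : C} (f : Y ⟶ Z) (X : C) : (-f) ▷ X = -(f ▷ X) :=
  (tensorRight X).map_neg

end

variable [BraidedCategory C]

theorem slide_naturality_left (e : C) {Y Y' : C} (f : Y ⟶ Y') (Z : C) :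
    f ▷ (e ⊗ Z) ≫ slide e Y' Z = slide e Y Z ≫ e ◁ f ▷ Z := by
  simp only [slide, Category.assoc]
  rw [associator_inv_naturality_left_assoc, ← comp_whiskerRight_assoc,
    BraidedCategory.braiding_naturality_left, comp_whiskerRight_assoc, associator_naturality_middle]

theorem slide_naturality_left_assoc (e : C) {Y Y' : C} (f : Y ⟶ Y') (Z : C) {W : C}
    (h : e ⊗ (Y' ⊗ Z) ⟶ W) :
    f ▷ (e ⊗ Z) ≫ slide e Y' Z ≫ h = slide e Y Z ≫ e ◁ f ▷ Z ≫ h := by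
  rw [← Category.assoc, slide_naturality_left, Category.assoc]

theorem slide_naturality_right (e Y : C) {Z Z' : C} (f : Z ⟶ Z') :
    Y ◁ e ◁ f ≫ slide e Y Z' = slide e Y Z ≫ e ◁ Y ◁ f := by
  simp only [slide, Category.assoc]
  rw [associator_inv_naturality_right_assoc, whisker_exchange_assoc, associator_naturality_right]

theorem slide_naturality_right_assoc (e Y : C) {Z Z' : C} (f : Z ⟶ Z') {W : C}
    (h : e ⊗ (Y ⊗ Z') ⟶ W) :
    Y ◁ e ◁ f ≫ slide e Y Z' ≫ h = slide e Y Z ≫ e ◁ Y ◁ f ≫ h := by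
  rw [← Category.assoc, slide_naturality_right, Category.assoc]

theorem slide_tensor (e X Y Z : C) :
    slide e (X ⊗ Y) Z = (α_ X Y (e ⊗ Z)).hom ≫ X ◁ slide e Y Z ≫ slide e X (Y ⊗ Z) ≫
      e ◁ (α_ X Y Z).inv := by
  simp only [slide, BraidedCategory.braiding_tensor_left_hom]
  monoidal

theorem slide_unit (e Y : C) : slide e (𝟙_ C) Y ≫ e ◁ (λ_ Y).hom = (λ_ (e ⊗ Y)).hom := by
  simp only [slide, braiding_tensorUnit_left]
  monoidal

theorem associator_slide (e X Y Z : C) :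
    (α_ X (e ⊗ Y) Z).hom ≫ X ◁ (α_ e Y Z).hom ≫ slide e X (Y ⊗ Z) =
      slide e X Y ▷ Z ≫ (α_ e (X ⊗ Y) Z).hom ≫ e ◁ (α_ X Y Z).hom := by
  simp only [slide]
  monoidal

/-- Moving a pair `e ⊗ e` past `Y` and contracting it is contracting it in place. This is the
naturality of the braiding of `Y` with `ξ`, and needs no transparency. -/
theorem cancelPair_whiskerLeft {e : C} (ξ : e ⊗ e ≅ 𝟙_ C) (Y Z : C) :
    slide e Y (e ⊗ Z) ≫ e ◁ slide e Y Z ≫ cancelPair ξ (Y ⊗ Z) = Y ◁ cancelPair ξ Z := by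
  have h : (β_ Y (e ⊗ e)).hom ≫ ξ.hom ▷ Y = Y ◁ ξ.hom ≫ (ρ_ Y).hom ≫ (λ_ Y).inv := by
    rw [← BraidedCategory.braiding_naturality_right, braiding_tensorUnit_right]
  calc _ = 𝟙 _ ⊗≫ ((β_ Y (e ⊗ e)).hom ≫ ξ.hom ▷ Y) ▷ Z ⊗≫ 𝟙 _ := by
        simp only [slide, cancelPair, BraidedCategory.braiding_tensor_right_hom]
        monoidal
    _ = _ := by
        rw [h]
        simp only [cancelPair]
        monoidal

theorem braiding_slide (e X Y : C) :
    (β_ X (e ⊗ Y)).hom ≫ (α_ e Y X).hom = slide e X Y ≫ e ◁ (β_ X Y).hom := by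
  simp only [slide, BraidedCategory.braiding_tensor_right_hom]
  monoidal

theorem slide_of_mem_symmetricCenter {e : C} (he : symmetricCenter C e) (X Y : C) :
    (β_ (e ⊗ X) Y).hom ≫ slide e Y X = (α_ e X Y).hom ≫ e ◁ (β_ X Y).hom := by
  calc _ = 𝟙 _ ⊗≫ e ◁ (β_ X Y).hom ⊗≫ ((β_ e Y).hom ≫ (β_ Y e).hom) ▷ X ⊗≫ 𝟙 _ := by
        simp only [slide, BraidedCategory.braiding_tensor_left_hom]
        monoidal
    _ = _ := by
        rw [he Y]
        monoidal

variable [Preadditive C] [MonoidalPreadditive C]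

theorem slide_self {e : C} (hβ : (β_ e e).hom = -𝟙 (e ⊗ e)) (Z : C) : slide e e Z = -𝟙 _ := by
  simp [slide, hβ, neg_whiskerRight]

/-- The two ways to move both factors `e` of `(e ⊗ Y) ⊗ (e ⊗ Z)` to the left differ by the
self-braiding of `e`. This is the sign in the superinterchange law. -/
theorem slide_whisker_anticomm {e : C} (hβ : (β_ e e).hom = -𝟙 (e ⊗ e)) (Y Z : C) :
    slide e (e ⊗ Y) Z ≫ e ◁ (α_ e Y Z).hom = -((α_ e Y (e ⊗ Z)).hom ≫ e ◁ slide e Y Z) := by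
  rw [slide_tensor, slide_self hβ]
  simp

/-- Moving a pair `e ⊗ e` past `e` uses the self-braiding of `e` twice, so the two ways to
contract `e ⊗ e ⊗ e` agree: composition in `Ĉ` is associative. -/
theorem cancelPair_comm {e : C} (hβ : (β_ e e).hom = -𝟙 (e ⊗ e)) (ξ : e ⊗ e ≅ 𝟙_ C) (Z : C) :
    e ◁ cancelPair ξ Z = cancelPair ξ (e ⊗ Z) := by
  rw [← cancelPair_whiskerLeft, slide_self hβ, slide_self hβ]
  simp [whiskerLeft_neg]

end OddEndofunctor

/-! ### Calculus of morphisms of `Ĉ` -/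

theorem ZMod.two_eq_zero_or_one (i : ZMod 2) : i = 0 ∨ i = 1 := by
  fin_cases i
  exacts [Or.inl rfl, Or.inr rfl]

section HatHom

open SuperOps

variable {C : Type u} [Category.{v} C] [MonoidalCategory C]

/-- The morphisms `X ⟶ Y` of `Ĉ`, as pairs of an even and an odd part. The definitions below
restate the operations of `hat` on these pairs, with which they agree by definition. -/
abbrev HatHom (e X Y : C) : Type v := (X ⟶ Y) × (X ⟶ e ⊗ Y)

variable [Preadditive C] {e : C} {ξ : e ⊗ e ≅ 𝟙_ C}

/-- A morphism of `C` as an even element of `HatHom`. -/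
def HatHom.of (e : C) {X Y : C} (f : X ⟶ Y) : HatHom e X Y := (f, 0)

/-- The composition of `Ĉ`. -/
def HatHom.comp (ξ : e ⊗ e ≅ 𝟙_ C) {X Y Z : C} (f : HatHom e X Y) (g : HatHom e Y Z) :
    HatHom e X Z :=
  (f.1 ≫ g.1 + f.2 ≫ e ◁ g.2 ≫ cancelPair ξ Z, f.1 ≫ g.2 + f.2 ≫ e ◁ g.1)

/-- The tensor product of morphisms of `Ĉ`. -/
def HatHom.tensor [BraidedCategory C] (ξ : e ⊗ e ≅ 𝟙_ C) {X Y X' Y' : C} (f : HatHom e X Y)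
    (f' : HatHom e X' Y') : HatHom e (X ⊗ X') (Y ⊗ Y') :=
  ((f.1 ⊗ₘ f'.1) - (f.2 ⊗ₘ f'.2) ≫ (α_ e Y (e ⊗ Y')).hom ≫ e ◁ slide e Y Y' ≫
      cancelPair ξ (Y ⊗ Y'),
    (f.1 ⊗ₘ f'.2) ≫ slide e Y Y' + (f.2 ⊗ₘ f'.1) ≫ (α_ e Y Y').hom)

/-- The homogeneous morphisms of `Ĉ` of a given parity. -/
def HatHom.parity (k : Type w) [Field k] [Linear k C] (e X Y : C) (i : ZMod 2) :
    Submodule k (HatHom e X Y) :=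
  if i = 0 then Submodule.prod ⊤ ⊥ else Submodule.prod ⊥ ⊤

namespace HatHom

@[simp] theorem of_fst {X Y : C} (f : X ⟶ Y) : (of e f).1 = f := rfl

@[simp] theorem of_snd {X Y : C} (f : X ⟶ Y) : (of e f).2 = 0 := rfl

@[simp] theorem comp_fst {X Y Z : C} (f : HatHom e X Y) (g : HatHom e Y Z) :
    (comp ξ f g).1 = f.1 ≫ g.1 + f.2 ≫ e ◁ g.2 ≫ cancelPair ξ Z := rfl

@[simp] theorem comp_snd {X Y Z : C} (f : HatHom e X Y) (g : HatHom e Y Z) :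
    (comp ξ f g).2 = f.1 ≫ g.2 + f.2 ≫ e ◁ g.1 := rfl

@[simp] theorem tensor_fst [BraidedCategory C] {X Y X' Y' : C} (f : HatHom e X Y)
    (f' : HatHom e X' Y') :
    (tensor ξ f f').1 = (f.1 ⊗ₘ f'.1) - (f.2 ⊗ₘ f'.2) ≫ (α_ e Y (e ⊗ Y')).hom ≫
      e ◁ slide e Y Y' ≫ cancelPair ξ (Y ⊗ Y') := rfl

@[simp] theorem tensor_snd [BraidedCategory C] {X Y X' Y' : C} (f : HatHom e X Y)
    (f' : HatHom e X' Y') :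
    (tensor ξ f f').2 = (f.1 ⊗ₘ f'.2) ≫ slide e Y Y' + (f.2 ⊗ₘ f'.1) ≫ (α_ e Y Y').hom := rfl

section

variable {k : Type w} [Field k] [Linear k C]

theorem mem_parity_zero {X Y : C} {f : HatHom e X Y} : f ∈ parity k e X Y 0 ↔ f.2 = 0 :=
  ⟨fun h => h.2, fun h => ⟨trivial, h⟩⟩

theorem mem_parity_one {X Y : C} {f : HatHom e X Y} : f ∈ parity k e X Y 1 ↔ f.1 = 0 :=
  ⟨fun h => h.1, fun h => ⟨h, trivial⟩⟩

theorem of_mem_parity {X Y : C} (f : X ⟶ Y) : of e f ∈ parity k e X Y 0 :=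
  mem_parity_zero.2 rfl

theorem isInternal_parity (X Y : C) : DirectSum.IsInternal (parity k e X Y) := by
  refine (DirectSum.isInternal_submodule_iff_isCompl (i := (0 : ZMod 2)) (j := 1) _ (by decide)
    (by ext i; simpa using ZMod.two_eq_zero_or_one i)).2 ⟨?_, ?_⟩
  · rw [Submodule.disjoint_def]
    intro f h₀ h₁
    exact Prod.ext (mem_parity_one.1 h₁) (mem_parity_zero.1 h₀)
  · rw [codisjoint_iff, eq_top_iff]
    intro f _
    exact Submodule.mem_sup.2 ⟨(f.1, 0), mem_parity_zero.2 rfl, (0, f.2), mem_parity_one.2 rfl,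
      Prod.ext (add_zero _) (zero_add _)⟩

@[simp] theorem sign_zero_left (i : ZMod 2) : sign k 0 i = 1 := by simp [sign]

@[simp] theorem sign_zero_right (i : ZMod 2) : sign k i 0 = 1 := by simp [sign]

@[simp] theorem sign_one_one : sign k 1 1 = -1 := by simp [sign, ZMod.val_one]

theorem smul_comp {X Y Z : C} (c : k) (f : HatHom e X Y) (g : HatHom e Y Z) :
    comp ξ (c • f) g = c • comp ξ f g := by
  ext <;> simp

end

theorem add_comp {X Y Z : C} (f f' : HatHom e X Y) (g : HatHom e Y Z) :
    comp ξ (f + f') g = comp ξ f g + comp ξ f' g := by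
  ext <;> simp <;> abel

@[simp] theorem of_id_comp {X Y : C} (f : HatHom e X Y) : comp ξ (of e (𝟙 X)) f = f := by
  ext <;> simp

variable [MonoidalPreadditive C]

@[simp] theorem comp_of_id {X Y : C} (f : HatHom e X Y) : comp ξ f (of e (𝟙 Y)) = f := by
  ext <;> simp

theorem of_comp_of {X Y Z : C} (f : X ⟶ Y) (g : Y ⟶ Z) :
    comp ξ (of e f) (of e g) = of e (f ≫ g) := by
  ext <;> simp

theorem comp_add {X Y Z : C} (f : HatHom e X Y) (g g' : HatHom e Y Z) :
    comp ξ f (g + g') = comp ξ f g + comp ξ f g' := by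
  ext <;> simp <;> abel

section

variable {k : Type w} [Field k] [Linear k C]

theorem comp_smul [MonoidalLinear k C] {X Y Z : C} (c : k) (f : HatHom e X Y) (g : HatHom e Y Z) :
    comp ξ f (c • g) = c • comp ξ f g := by
  ext <;> simp

theorem comp_mem_parity {X Y Z : C} {i j : ZMod 2} {f : HatHom e X Y} {g : HatHom e Y Z}
    (hf : f ∈ parity k e X Y i) (hg : g ∈ parity k e Y Z j) :
    comp ξ f g ∈ parity k e X Z (i + j) := by
  obtain rfl | rfl := ZMod.two_eq_zero_or_one i <;>
  obtain rfl | rfl := ZMod.two_eq_zero_or_one j <;>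
  simp only [mem_parity_zero, mem_parity_one, add_zero, zero_add, CharTwo.add_self_eq_zero]
    at hf hg ⊢ <;> simp [hf, hg]

end

variable [BraidedCategory C]

theorem comp_assoc (hβ : (β_ e e).hom = -𝟙 (e ⊗ e)) {W X Y Z : C} (f : HatHom e W X)
    (g : HatHom e X Y) (h : HatHom e Y Z) :
    comp ξ (comp ξ f g) h = comp ξ f (comp ξ g h) := by
  ext
  · simp [cancelPair_naturality]
    abel
  · simp [cancelPair_comm hβ, cancelPair_naturality]
    abel

theorem of_tensor_of {X Y X' Y' : C} (f : X ⟶ Y) (f' : X' ⟶ Y') :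
    tensor ξ (of e f) (of e f') = of e (f ⊗ₘ f') := by
  ext <;> simp

theorem tensor_of_id_of_id (X Y : C) : tensor ξ (of e (𝟙 X)) (of e (𝟙 Y)) = of e (𝟙 (X ⊗ Y)) := by
  simp [of_tensor_of]

theorem add_tensor {X Y X' Y' : C} (f g : HatHom e X Y) (f' : HatHom e X' Y') :
    tensor ξ (f + g) f' = tensor ξ f f' + tensor ξ g f' := by
  ext <;> simp [MonoidalPreadditive.add_tensor] <;> abel

theorem tensor_add {X Y X' Y' : C} (f : HatHom e X Y) (f' g' : HatHom e X' Y') :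
    tensor ξ f (f' + g') = tensor ξ f f' + tensor ξ f g' := by
  ext <;> simp [MonoidalPreadditive.tensor_add] <;> abel

/-- Every tensor product of morphisms is a composite of two whiskerings, without a sign in this
order. The axioms of a monoidal supercategory and of a braiding reduce to those for
whiskerings. -/
theorem tensor_def (hβ : (β_ e e).hom = -𝟙 (e ⊗ e)) {X Y X' Y' : C} (f : HatHom e X Y)
    (f' : HatHom e X' Y') :
    tensor ξ f f' = comp ξ (tensor ξ (of e (𝟙 X)) f') (tensor ξ f (of e (𝟙 Y'))) := by
  ext
  · simp [MonoidalCategory.tensorHom_def', ← slide_naturality_left_assoc, sub_eq_add_neg]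
    have := slide_whisker_anticomm hβ Y Y' =≫ cancelPair ξ (Y ⊗ Y')
    simp only [Category.assoc, Preadditive.neg_comp] at this
    rw [this]
    simp
  · simp [MonoidalCategory.tensorHom_def', ← slide_naturality_left, add_comm]

theorem id_tensor_comp (X : C) {X' Y' Z' : C} (f : HatHom e X' Y') (g : HatHom e Y' Z') :
    tensor ξ (of e (𝟙 X)) (comp ξ f g) =
      comp ξ (tensor ξ (of e (𝟙 X)) f) (tensor ξ (of e (𝟙 X)) g) := by
  ext
  · simp [← cancelPair_whiskerLeft, ← slide_naturality_right_assoc]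
  · simp [← slide_naturality_right]

theorem comp_tensor_id {X Y Z : C} (f : HatHom e X Y) (g : HatHom e Y Z) (X' : C) :
    tensor ξ (comp ξ f g) (of e (𝟙 X')) =
      comp ξ (tensor ξ f (of e (𝟙 X'))) (tensor ξ g (of e (𝟙 X'))) := by
  ext
  · simp [← cancelPair_whiskerRight]
  · simp

theorem associator_naturality_right (X Y : C) {Z Z' : C} (h : HatHom e Z Z') :
    comp ξ (tensor ξ (of e (𝟙 (X ⊗ Y))) h) (of e (α_ X Y Z').hom) =
      comp ξ (of e (α_ X Y Z).hom)
        (tensor ξ (of e (𝟙 X)) (tensor ξ (of e (𝟙 Y)) h)) := by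
  ext
  · simp
  · simp [slide_tensor]

theorem associator_naturality_middle (X : C) {Y Y' : C} (g : HatHom e Y Y') (Z : C) :
    comp ξ (tensor ξ (tensor ξ (of e (𝟙 X)) g) (of e (𝟙 Z))) (of e (α_ X Y' Z).hom) =
      comp ξ (of e (α_ X Y Z).hom)
        (tensor ξ (of e (𝟙 X)) (tensor ξ g (of e (𝟙 Z)))) := by
  ext
  · simp
  · simp [← associator_slide]

theorem associator_naturality_left {X X' : C} (f : HatHom e X X') (Y Z : C) :
    comp ξ (tensor ξ (tensor ξ f (of e (𝟙 Y))) (of e (𝟙 Z))) (of e (α_ X' Y Z).hom) =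
      comp ξ (of e (α_ X Y Z).hom) (tensor ξ f (of e (𝟙 (Y ⊗ Z)))) := by
  ext
  · simp
  · simp

theorem associator_naturality (hβ : (β_ e e).hom = -𝟙 (e ⊗ e)) {X Y Z X' Y' Z' : C}
    (f : HatHom e X X') (g : HatHom e Y Y') (h : HatHom e Z Z') :
    comp ξ (tensor ξ (tensor ξ f g) h) (of e (α_ X' Y' Z').hom) =
      comp ξ (of e (α_ X Y Z).hom) (tensor ξ f (tensor ξ g h)) := by
  rw [tensor_def hβ (tensor ξ f g) h, tensor_def hβ f g, tensor_def hβ f (tensor ξ g h),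
    tensor_def hβ g h, comp_tensor_id, id_tensor_comp, comp_assoc hβ, comp_assoc hβ,
    associator_naturality_left, ← comp_assoc hβ _ (of e (α_ _ _ _).hom),
    associator_naturality_middle, comp_assoc hβ (of e _), ← comp_assoc hβ _ (of e _),
    associator_naturality_right]
  simp only [comp_assoc hβ]

theorem leftUnitor_naturality {X Y : C} (f : HatHom e X Y) :
    comp ξ (tensor ξ (of e (𝟙 (𝟙_ C))) f) (of e (λ_ Y).hom) = comp ξ (of e (λ_ X).hom) f := by
  ext
  · simp
  · simp [slide_unit]

theorem rightUnitor_naturality {X Y : C} (f : HatHom e X Y) :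
    comp ξ (tensor ξ f (of e (𝟙 (𝟙_ C)))) (of e (ρ_ Y).hom) = comp ξ (of e (ρ_ X).hom) f := by
  ext
  · simp
  · simp

theorem id_tensor_comp_braiding (X : C) {Y Y' : C} (g : HatHom e Y Y') :
    comp ξ (tensor ξ (of e (𝟙 X)) g) (of e (β_ X Y').hom) =
      comp ξ (of e (β_ X Y).hom) (tensor ξ g (of e (𝟙 X))) := by
  ext
  · simp
  · simp
    rw [← braiding_slide, BraidedCategory.braiding_naturality_right_assoc]

theorem tensor_id_comp_braiding (he : symmetricCenter C e) {X X' : C} (f : HatHom e X X') (Y : C) :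
    comp ξ (tensor ξ f (of e (𝟙 Y))) (of e (β_ X' Y).hom) =
      comp ξ (of e (β_ X Y).hom) (tensor ξ (of e (𝟙 Y)) f) := by
  ext
  · simp
  · simp
    rw [← slide_of_mem_symmetricCenter he, BraidedCategory.braiding_naturality_left_assoc]

theorem of_pentagon (W X Y Z : C) :
    comp ξ (tensor ξ (of e (α_ W X Y).hom) (of e (𝟙 Z))) (comp ξ (of e (α_ W (X ⊗ Y) Z).hom)
        (tensor ξ (of e (𝟙 W)) (of e (α_ X Y Z).hom))) =
      comp ξ (of e (α_ (W ⊗ X) Y Z).hom) (of e (α_ W X (Y ⊗ Z)).hom) := by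
  simp only [of_tensor_of, of_comp_of, tensorHom_id, id_tensorHom, pentagon]

theorem of_triangle (X Y : C) :
    comp ξ (of e (α_ X (𝟙_ C) Y).hom) (tensor ξ (of e (𝟙 X)) (of e (λ_ Y).hom)) =
      tensor ξ (of e (ρ_ X).hom) (of e (𝟙 Y)) := by
  simp only [of_tensor_of, of_comp_of, tensorHom_id, id_tensorHom, triangle]

theorem of_hexagon_forward (X Y Z : C) :
    comp ξ (of e (α_ X Y Z).hom) (comp ξ (of e (β_ X (Y ⊗ Z)).hom) (of e (α_ Y Z X).hom)) =
      comp ξ (tensor ξ (of e (β_ X Y).hom) (of e (𝟙 Z)))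
        (comp ξ (of e (α_ Y X Z).hom) (tensor ξ (of e (𝟙 Y)) (of e (β_ X Z).hom))) := by
  simp only [of_tensor_of, of_comp_of, tensorHom_id, id_tensorHom,
    BraidedCategory.hexagon_forward]

theorem of_hexagon_reverse (X Y Z : C) :
    comp ξ (of e (α_ X Y Z).inv) (comp ξ (of e (β_ (X ⊗ Y) Z).hom) (of e (α_ Z X Y).inv)) =
      comp ξ (tensor ξ (of e (𝟙 X)) (of e (β_ Y Z).hom))
        (comp ξ (of e (α_ X Z Y).inv) (tensor ξ (of e (β_ X Z).hom) (of e (𝟙 Y)))) := by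
  simp only [of_tensor_of, of_comp_of, tensorHom_id, id_tensorHom,
    BraidedCategory.hexagon_reverse]

theorem of_zigzag (X Y : C) [ExactPairing X Y] :
    comp ξ (of e (λ_ X).inv) (comp ξ (tensor ξ (of e (η_ X Y)) (of e (𝟙 X)))
      (comp ξ (of e (α_ X Y X).hom) (comp ξ (tensor ξ (of e (𝟙 X)) (of e (ε_ X Y)))
        (of e (ρ_ X).hom)))) = of e (𝟙 X) := by
  simp only [of_tensor_of, of_comp_of, tensorHom_id, id_tensorHom,
    ExactPairing.evaluation_coevaluation_assoc, Iso.inv_hom_id_assoc, Iso.inv_hom_id]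

theorem of_zigzag' (X Y : C) [ExactPairing X Y] :
    comp ξ (of e (ρ_ Y).inv) (comp ξ (tensor ξ (of e (𝟙 Y)) (of e (η_ X Y)))
      (comp ξ (of e (α_ Y X Y).inv) (comp ξ (tensor ξ (of e (ε_ X Y)) (of e (𝟙 Y)))
        (of e (λ_ Y).hom)))) = of e (𝟙 Y) := by
  simp only [of_tensor_of, of_comp_of, tensorHom_id, id_tensorHom,
    ExactPairing.coevaluation_evaluation_assoc, Iso.inv_hom_id_assoc, Iso.inv_hom_id]

variable {k : Type w} [Field k] [Linear k C]

theorem tensor_mem_parity {X Y X' Y' : C} {i j : ZMod 2} {f : HatHom e X Y} {f' : HatHom e X' Y'}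
    (hf : f ∈ parity k e X Y i) (hf' : f' ∈ parity k e X' Y' j) :
    tensor ξ f f' ∈ parity k e (X ⊗ X') (Y ⊗ Y') (i + j) := by
  obtain rfl | rfl := ZMod.two_eq_zero_or_one i <;>
  obtain rfl | rfl := ZMod.two_eq_zero_or_one j <;>
  simp only [mem_parity_zero, mem_parity_one, add_zero, zero_add, CharTwo.add_self_eq_zero]
    at hf hf' ⊢ <;> simp [hf, hf']

/-- In the other order, the composite of the two whiskerings has the sign of the odd-odd part of
the tensor product. -/
theorem tensor_id_comp_id_tensor {X Y X' Y' : C} {i j : ZMod 2} {f : HatHom e X Y}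
    {g : HatHom e X' Y'} (hf : f ∈ parity k e X Y i) (hg : g ∈ parity k e X' Y' j) :
    comp ξ (tensor ξ f (of e (𝟙 X'))) (tensor ξ (of e (𝟙 Y)) g) =
      sign k j i • tensor ξ f g := by
  obtain rfl | rfl := ZMod.two_eq_zero_or_one i <;>
  obtain rfl | rfl := ZMod.two_eq_zero_or_one j <;>
  simp only [mem_parity_zero, mem_parity_one] at hf hg <;>
  ext <;> simp [hf, hg, MonoidalCategory.tensorHom_def]

variable [MonoidalLinear k C]

theorem smul_tensor {X Y X' Y' : C} (c : k) (f : HatHom e X Y) (f' : HatHom e X' Y') :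
    tensor ξ (c • f) f' = c • tensor ξ f f' := by
  ext <;> simp [MonoidalCategory.tensorHom_def, smul_sub]

theorem tensor_smul {X Y X' Y' : C} (c : k) (f : HatHom e X Y) (f' : HatHom e X' Y') :
    tensor ξ f (c • f') = c • tensor ξ f f' := by
  ext <;> simp [MonoidalCategory.tensorHom_def, smul_sub]

theorem superinterchange (hβ : (β_ e e).hom = -𝟙 (e ⊗ e)) {X Y Z X' Y' Z' : C}
    {i j' : ZMod 2} {f : HatHom e X Y} (f' : HatHom e X' Y')
    (g : HatHom e Y Z) {g' : HatHom e Y' Z'}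
    (hf : f ∈ parity k e X Y i) (hg' : g' ∈ parity k e Y' Z' j') :
    comp ξ (tensor ξ f f') (tensor ξ g g') =
      sign k j' i • tensor ξ (comp ξ f g) (comp ξ f' g') := by
  rw [tensor_def hβ f f', tensor_def hβ g g', comp_assoc hβ,
    ← comp_assoc hβ (tensor ξ f _), tensor_id_comp_id_tensor hf hg', smul_comp, comp_smul,
    tensor_def hβ f g', tensor_def hβ (comp ξ f g), comp_tensor_id, id_tensor_comp]
  simp only [comp_assoc hβ]

theorem braiding_naturality (he : symmetricCenter C e) (hβ : (β_ e e).hom = -𝟙 (e ⊗ e))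
    {X Y X' Y' : C} {i j : ZMod 2} {f : HatHom e X X'} {g : HatHom e Y Y'}
    (hf : f ∈ parity k e X X' i) (hg : g ∈ parity k e Y Y' j) :
    comp ξ (tensor ξ f g) (of e (β_ X' Y').hom) =
      sign k i j • comp ξ (of e (β_ X Y).hom) (tensor ξ g f) := by
  rw [tensor_def hβ f g, comp_assoc hβ, tensor_id_comp_braiding he, ← comp_assoc hβ,
    id_tensor_comp_braiding, comp_assoc hβ, tensor_id_comp_id_tensor hg hf, comp_smul]

end HatHom

end HatHom

/-! ### The axioms of a rigid braided monoidal supercategory -/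

section Hat

open SuperOps

variable {k : Type w} [Field k] {C : Type u} [Category.{v} C] [MonoidalCategory C]
  [Preadditive C] [MonoidalPreadditive C] [Linear k C] [BraidedCategory C]
  {e : C} {ξ : e ⊗ e ≅ 𝟙_ C}

theorem hat_isEvenInverse {X Y : C} (f : X ≅ Y) :
    (hat k e ξ).IsEvenInverse (hatEven k e ξ f.hom) (hatEven k e ξ f.inv) where
  hom_mem := HatHom.of_mem_parity f.hom
  inv_mem := HatHom.of_mem_parity f.inv
  hom_inv := (HatHom.of_comp_of f.hom f.inv).trans (congrArg (HatHom.of e) f.hom_inv_id)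
  inv_hom := (HatHom.of_comp_of f.inv f.hom).trans (congrArg (HatHom.of e) f.inv_hom_id)

theorem hat_isDualPair (X Y : C) [ExactPairing X Y] :
    (hat k e ξ).IsDualPair X Y (hatEven k e ξ (ε_ X Y)) (hatEven k e ξ (η_ X Y)) where
  ev_mem := HatHom.of_mem_parity _
  coev_mem := HatHom.of_mem_parity _
  zigzag := HatHom.of_zigzag X Y
  zigzag' := HatHom.of_zigzag' X Y

theorem hat_isRigid [RigidCategory C] : (hat k e ξ).IsRigid (hatDual k e ξ) where
  left_dual X := hat_isDualPair X (HasRightDual.rightDual X)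
  right_dual X := ⟨HasLeftDual.leftDual X, _, _, hat_isDualPair (HasLeftDual.leftDual X) X⟩

variable [MonoidalLinear k C]

theorem hat_isSupercategory (hfin : ∀ X Y : C, Module.Finite k (X ⟶ Y))
    (hβ : (β_ e e).hom = -𝟙 (e ⊗ e)) : (hat k e ξ).IsSupercategory where
  finite X Y := by
    have := hfin X Y
    have := hfin X (e ⊗ Y)
    exact inferInstanceAs (Module.Finite k (HatHom e X Y))
  isInternal := HatHom.isInternal_parity
  id_mem X := HatHom.of_mem_parity (𝟙 X)
  comp_mem _ _ _ _ := HatHom.comp_mem_parity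
  add_comp := HatHom.add_comp
  comp_add := HatHom.comp_add
  smul_comp := HatHom.smul_comp
  comp_smul := HatHom.comp_smul
  id_comp := HatHom.of_id_comp
  comp_id := HatHom.comp_of_id
  assoc := HatHom.comp_assoc hβ

theorem hat_isMonoidalSupercategory (hfin : ∀ X Y : C, Module.Finite k (X ⟶ Y))
    (hβ : (β_ e e).hom = -𝟙 (e ⊗ e)) : (hat k e ξ).IsMonoidalSupercategory where
  toIsSupercategory := hat_isSupercategory hfin hβ
  tensor_mem _ _ _ _ := HatHom.tensor_mem_parity
  add_tensor := HatHom.add_tensor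
  tensor_add := HatHom.tensor_add
  smul_tensor := HatHom.smul_tensor
  tensor_smul := HatHom.tensor_smul
  tensor_id := HatHom.tensor_of_id_of_id
  superinterchange _ _ _ _ _ f' g _ hf _ _ hg' := HatHom.superinterchange hβ f' g hf hg'
  assoc_iso X Y Z := hat_isEvenInverse (α_ X Y Z)
  left_iso X := hat_isEvenInverse (λ_ X)
  right_iso X := hat_isEvenInverse (ρ_ X)
  assoc_naturality := HatHom.associator_naturality hβ
  left_naturality := HatHom.leftUnitor_naturality
  right_naturality := HatHom.rightUnitor_naturality
  pentagon := HatHom.of_pentagon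
  triangle := HatHom.of_triangle

theorem hat_isBraiding (he : symmetricCenter C e) (hβ : (β_ e e).hom = -𝟙 (e ⊗ e)) :
    (hat k e ξ).IsBraiding (fun X Y => hatEven k e ξ (β_ X Y).hom) where
  iso X Y := ⟨_, hat_isEvenInverse (β_ X Y)⟩
  naturality _ _ _ _ := HatHom.braiding_naturality he hβ
  hexagon_forward := HatHom.of_hexagon_forward
  hexagon_reverse := HatHom.of_hexagon_reverse

end Hat

/-! ### The self-braiding of `e` -/

namespace SVect

variable {k : Type w} [Field k]

theorem even_eq_top_or_odd_eq_top {V : SVect k} (h : Module.finrank k V.carrier = 1) :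
    V.even = ⊤ ∨ V.odd = ⊤ := by
  have hsum := Submodule.finrank_add_eq_of_isCompl V.isCompl
  rw [h] at hsum
  obtain h1 | h1 : Module.finrank k V.even = 1 ∨ Module.finrank k V.odd = 1 := by lia
  · exact Or.inl (Submodule.eq_top_of_finrank_eq (h1.trans h.symm))
  · exact Or.inr (Submodule.eq_top_of_finrank_eq (h1.trans h.symm))

theorem nonempty_iso_unit {V : SVect k} (h : Module.finrank k V.carrier = 1) (hV : V.even = ⊤) :
    Nonempty (V ≅ 𝟙_ (SVect k)) :=
  ⟨mkIso (W := unit k) (LinearEquiv.ofFinrankEq V.carrier k (by simp [h])) fun v => by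
    rw [oddProj_eq_zero_iff.2 (hV ▸ Submodule.mem_top : v ∈ V.even), map_zero]
    exact oddProj_unit _⟩

theorem braiding_self_of_odd_eq_top {V : SVect k} (h : Module.finrank k V.carrier = 1)
    (hV : V.odd = ⊤) : (β_ V V).hom = -𝟙 (V ⊗ V) := by
  obtain ⟨x, -, hx⟩ := finrank_eq_one_iff'.1 h
  refine hom_ext (TensorProduct.ext' fun v w => ?_)
  refine (swapMap_of_odd (V := V) (W := V) (hV ▸ Submodule.mem_top) (hV ▸ Submodule.mem_top)).trans
    (congrArg Neg.neg ?_)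
  obtain ⟨a, rfl⟩ := hx v
  obtain ⟨b, rfl⟩ := hx w
  change _ = (a • x) ⊗ₜ[k] (b • x)
  rw [TensorProduct.smul_tmul_smul, TensorProduct.smul_tmul_smul, mul_comm]

theorem finrank_eq_one_of_tensor_self {V : SVect k} (i : V ⊗ V ≅ 𝟙_ (SVect k)) :
    Module.finrank k V.carrier = 1 := by
  let l : V.carrier ⊗[k] V.carrier ≃ₗ[k] k := LinearEquiv.ofLinearMap i.hom.1 i.inv.1
    (congrArg Subtype.val i.inv_hom_id) (congrArg Subtype.val i.hom_inv_id)
  have := l.finrank_eq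
  rw [Module.finrank_tensorProduct, Module.finrank_self] at this
  exact Nat.eq_one_of_mul_eq_one_left this

end SVect

/-- In the symmetric center of a slightly degenerate category, an object with square `𝟙` other
than the unit corresponds to the odd line of superspaces, so that its self-braiding is `-1`. -/
theorem IsSlightlyDegenerate.braiding_self {k : Type w} [Field k] {C : Type u} [Category.{v} C]
    [Preadditive C] [Linear k C] [MonoidalCategory C] [BraidedCategory C]
    (hdeg : IsSlightlyDegenerate k C) {e : C} (he : symmetricCenter C e)
    (hunit : IsEmpty (e ≅ 𝟙_ C)) (ξ : e ⊗ e ≅ 𝟙_ C) : (β_ e e).hom = -𝟙 (e ⊗ e) := by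
  obtain ⟨F, hF, _, -, ⟨_⟩⟩ := hdeg
  let E : (symmetricCenter C).FullSubcategory := ⟨e, he⟩
  let ξE : E ⊗ E ≅ 𝟙_ _ := (symmetricCenter C).ι.preimageIso ξ
  have h := SVect.finrank_eq_one_of_tensor_self
    (Functor.Monoidal.μIso F E E ≪≫ F.mapIso ξE ≪≫ (Functor.Monoidal.εIso F).symm)
  obtain hV | hV := SVect.even_eq_top_or_odd_eq_top h
  · obtain ⟨j⟩ := SVect.nonempty_iso_unit h hV
    exact (hunit.false ((symmetricCenter C).ι.mapIso
      (F.preimageIso (j ≪≫ Functor.Monoidal.εIso F)))).elim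
  · have hE : (β_ E E).hom = -𝟙 (E ⊗ E) := by
      apply F.map_injective
      rw [Functor.map_braiding, SVect.braiding_self_of_odd_eq_top h hV]
      simp
    exact congrArg (symmetricCenter C).ι.map hE

/-! ### Duals of odd morphisms -/

section OddMate

open HasRightDual

variable {C : Type u} [Category.{v} C] [MonoidalCategory C]

/-- A morphism to a dual object is determined by its pairing with that object. -/
theorem hom_rightDual_ext {W Z : C} [HasRightDual Z] {g h : W ⟶ rightDual Z}
    (w : g ▷ Z ≫ ε_ Z (rightDual Z) = h ▷ Z ≫ ε_ Z (rightDual Z)) : g = h := by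
  have := congrArg (tensorRightHomEquiv W Z (rightDual Z) (𝟙_ C)) w
  rwa [tensorRightHomEquiv_whiskerRight_comp_evaluation,
    tensorRightHomEquiv_whiskerRight_comp_evaluation, cancel_mono] at this

theorem tensorDualIso_comp_evaluation [RightRigidCategory C] (X Y : C) :
    (tensorDualIso X Y).hom ▷ (X ⊗ Y) ≫ ε_ (X ⊗ Y) (rightDual (X ⊗ Y)) =
      𝟙 _ ⊗≫ rightDual Y ◁ (ε_ X (rightDual X) ▷ Y) ⊗≫ ε_ Y (rightDual Y) := by
  have := @rightAdjointMate_comp_evaluation C _ _ (X ⊗ Y) (X ⊗ Y) (RightRigidCategory.rightDual _)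
    hasRightDualTensor (𝟙 _)
  refine this.trans ?_
  rw [MonoidalCategory.whiskerLeft_id, Category.id_comp]
  rfl

theorem tensorDoubleDual_comp_evaluation [RightRigidCategory C] (X Y : C) :
    (rightDual (rightDual X) ⊗ rightDual (rightDual Y)) ◁ (tensorDualIso X Y).hom ≫
      tensorDoubleDual X Y ▷ rightDual (X ⊗ Y) ≫
        ε_ (rightDual (X ⊗ Y)) (rightDual (rightDual (X ⊗ Y))) =
      𝟙 _ ⊗≫ rightDual (rightDual X) ◁ (ε_ (rightDual Y) (rightDual (rightDual Y)) ▷ rightDual X)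
        ⊗≫ ε_ (rightDual X) (rightDual (rightDual X)) := by
  rw [tensorDoubleDual, comp_whiskerRight, Category.assoc, rightAdjointMate_comp_evaluation,
    ← tensorDualIso_comp_evaluation, ← whisker_exchange_assoc,
    ← MonoidalCategory.whiskerLeft_comp_assoc]
  simp

variable [BraidedCategory C]

theorem braiding_braiding_of_mem {e : C} (he : symmetricCenter C e) (X : C) :
    (β_ X e).hom ≫ (β_ e X).hom = 𝟙 (X ⊗ e) := by
  rw [← cancel_epi (β_ e X).hom, ← Category.assoc, he X, Category.id_comp, Category.comp_id]

/-- The dual `Y* ⟶ e ⊗ X*` of an odd morphism `f : X ⟶ e ⊗ Y`. -/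
def oddMate {e X Y : C} [HasRightDual X] [HasRightDual Y] (f : X ⟶ e ⊗ Y) :
    rightDual Y ⟶ e ⊗ rightDual X :=
  (ρ_ _).inv ≫ rightDual Y ◁ η_ X (rightDual X) ≫
    rightDual Y ◁ (f ▷ rightDual X ≫ (α_ e Y (rightDual X)).hom) ≫
    slide e (rightDual Y) (Y ⊗ rightDual X) ≫
    e ◁ ((α_ (rightDual Y) Y (rightDual X)).inv ≫ ε_ Y (rightDual Y) ▷ rightDual X ≫ (λ_ _).hom)

theorem oddMate_comp_evaluation {e X Y : C} [HasRightDual X] [HasRightDual Y] (f : X ⟶ e ⊗ Y) :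
    oddMate f ▷ X ≫ (α_ e (rightDual X) X).hom ≫ e ◁ ε_ X (rightDual X) =
      rightDual Y ◁ f ≫ slide e (rightDual Y) Y ≫ e ◁ ε_ Y (rightDual Y) := by
  set A := rightDual Y ◁ f ≫ slide e (rightDual Y) Y ≫ e ◁ ε_ Y (rightDual Y) with hA
  have h : oddMate f = tensorRightHomEquiv _ X (rightDual X) _ A ≫ (α_ _ _ _).hom ≫
      e ◁ (λ_ _).hom := by
    simp only [oddMate, tensorRightHomEquiv, Equiv.coe_fn_mk, hA, slide]
    monoidal
  rw [h]
  conv_rhs => rw [← (tensorRightHomEquiv _ X (rightDual X) _).symm_apply_apply A]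
  generalize tensorRightHomEquiv _ X (rightDual X) _ A = B
  simp only [tensorRightHomEquiv, Equiv.coe_fn_symm_mk]
  monoidal

theorem drinfeld_comp_evaluation (X : C) [RightRigidCategory C] :
    drinfeld X ▷ rightDual X ≫ ε_ (rightDual X) (rightDual (rightDual X)) =
      (β_ X (rightDual X)).hom ≫ ε_ X (rightDual X) := by
  set A := (β_ X (rightDual X)).hom ≫ ε_ X (rightDual X) with hA
  have h : drinfeld X = tensorRightHomEquiv _ (rightDual X) (rightDual (rightDual X)) _ A ≫
      (λ_ _).hom := by
    simp only [drinfeld, tensorRightHomEquiv, Equiv.coe_fn_mk, hA]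
    monoidal
  rw [h]
  conv_rhs =>
    rw [← (tensorRightHomEquiv _ (rightDual X) (rightDual (rightDual X)) _).symm_apply_apply A]
  generalize tensorRightHomEquiv _ (rightDual X) (rightDual (rightDual X)) _ A = B
  simp only [tensorRightHomEquiv, Equiv.coe_fn_symm_mk]
  monoidal

/-- A morphism `p : W ⟶ 𝟙` between `e` and `e*` can be moved out of the pairing of `e` with `e*`, by
naturality of the braiding of `e` with `p`. -/
theorem whisker_comp_braiding_evaluation (e W : C) [HasRightDual e] (p : W ⟶ 𝟙_ C) :
    (e ◁ p) ▷ rightDual e ⊗≫ (β_ e (rightDual e)).hom ≫ ε_ e (rightDual e) =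
      𝟙 _ ⊗≫ (β_ e (W ⊗ rightDual e)).hom ⊗≫ W ◁ ε_ e (rightDual e) ⊗≫ p := by
  symm
  calc _ = 𝟙 _ ⊗≫ (β_ e (W ⊗ rightDual e)).hom ⊗≫
        (W ◁ ε_ e (rightDual e) ≫ p ▷ (𝟙_ C)) ⊗≫ 𝟙 _ := by monoidal
    _ = 𝟙 _ ⊗≫ ((β_ e (W ⊗ rightDual e)).hom ≫ (p ▷ rightDual e) ▷ e) ⊗≫
        ε_ e (rightDual e) ⊗≫ 𝟙 _ := by
      rw [whisker_exchange]
      monoidal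
    _ = _ := by
      rw [← BraidedCategory.braiding_naturality_right, BraidedCategory.braiding_tensor_right_hom,
        braiding_tensorUnit_right]
      monoidal

/-- A transparent `e` and its dual can be paired around the strand of `ε_ X`, instead of across it:
`e*` moves to the left of `X`, then `e` moves to the right of `X* ⊗ e*`. -/
theorem evaluation_comp_braiding_evaluation {e : C} (he : symmetricCenter C e) (X : C)
    [HasRightDual e] [HasRightDual X] :
    (e ◁ ε_ X (rightDual X)) ▷ rightDual e ⊗≫ (β_ e (rightDual e)).hom ≫ ε_ e (rightDual e) =
      𝟙 _ ⊗≫ (e ⊗ rightDual X) ◁ (β_ X (rightDual e)).hom ⊗≫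
        (β_ e (rightDual X ⊗ rightDual e)).hom ▷ X ⊗≫
        rightDual X ◁ ε_ e (rightDual e) ▷ X ⊗≫ ε_ X (rightDual X) := by
  have h : (β_ X (rightDual e ⊗ e)).hom ≫ ε_ e (rightDual e) ▷ X =
      X ◁ ε_ e (rightDual e) ≫ (ρ_ X).hom ≫ (λ_ X).inv := by
    rw [← BraidedCategory.braiding_naturality_right, braiding_tensorUnit_right]
  rw [whisker_comp_braiding_evaluation]
  calc _ = 𝟙 _ ⊗≫ (β_ e (rightDual X ⊗ (X ⊗ rightDual e))).hom ⊗≫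
        rightDual X ◁ (X ◁ ε_ e (rightDual e) ≫ (ρ_ X).hom ≫ (λ_ X).inv) ⊗≫
        ε_ X (rightDual X) := by
        simp only [BraidedCategory.braiding_tensor_right_hom]
        monoidal
    _ = 𝟙 _ ⊗≫ ((β_ e (rightDual X ⊗ (X ⊗ rightDual e))).hom ≫
        (rightDual X ◁ (β_ X (rightDual e)).hom) ▷ e) ⊗≫
        rightDual X ◁ rightDual e ◁ (β_ X e).hom ⊗≫
        rightDual X ◁ ε_ e (rightDual e) ▷ X ⊗≫ ε_ X (rightDual X) := by
        rw [← h]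
        simp only [BraidedCategory.braiding_tensor_right_hom]
        monoidal
    _ = 𝟙 _ ⊗≫ (e ⊗ rightDual X) ◁ (β_ X (rightDual e)).hom ⊗≫
        (β_ e (rightDual X ⊗ rightDual e)).hom ▷ X ⊗≫
        (rightDual X ⊗ rightDual e) ◁ ((β_ e X).hom ≫ (β_ X e).hom) ⊗≫
        rightDual X ◁ ε_ e (rightDual e) ▷ X ⊗≫ ε_ X (rightDual X) := by
        rw [← BraidedCategory.braiding_naturality_right]
        simp only [BraidedCategory.braiding_tensor_right_hom]
        monoidal
    _ = _ := by
        rw [he X]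
        monoidal

/-- The dual of `f : X ⟶ e ⊗ Y` in `C`, in terms of its dual `oddMate f` as an odd morphism. -/
theorem tensorDualIso_comp_rightAdjointMate [RightRigidCategory C] {e : C}
    (he : symmetricCenter C e) {X Y : C} (f : X ⟶ e ⊗ Y) :
    (tensorDualIso e Y).hom ≫ rightAdjointMate f = oddMate f ▷ rightDual e ⊗≫
      (β_ e (rightDual X ⊗ rightDual e)).hom ⊗≫ rightDual X ◁ ε_ e (rightDual e) ⊗≫ 𝟙 _ := by
  apply hom_rightDual_ext
  -- With `X` moved to the left of `e*`, it is next to `oddMate f` and can be paired with it.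
  rw [← cancel_epi (α_ _ _ _).inv, ← cancel_epi (rightDual Y ◁ (β_ X (rightDual e)).hom)]
  rw [comp_whiskerRight, Category.assoc, rightAdjointMate_comp_evaluation, ← whisker_exchange_assoc,
    tensorDualIso_comp_evaluation]
  symm
  calc _ = 𝟙 _ ⊗≫ (rightDual Y ◁ (β_ X (rightDual e)).hom ≫ oddMate f ▷ (rightDual e ⊗ X)) ⊗≫
        (β_ e (rightDual X ⊗ rightDual e)).hom ▷ X ⊗≫
        rightDual X ◁ ε_ e (rightDual e) ▷ X ⊗≫ ε_ X (rightDual X) := by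
        monoidal
    _ = 𝟙 _ ⊗≫ oddMate f ▷ (X ⊗ rightDual e) ⊗≫
        (𝟙 ((e ⊗ (rightDual X ⊗ X)) ⊗ rightDual e) ⊗≫
        (e ⊗ rightDual X) ◁ (β_ X (rightDual e)).hom ⊗≫
        (β_ e (rightDual X ⊗ rightDual e)).hom ▷ X ⊗≫
        rightDual X ◁ ε_ e (rightDual e) ▷ X ⊗≫ ε_ X (rightDual X)) := by
        rw [whisker_exchange]
        monoidal
    _ = 𝟙 _ ⊗≫ (oddMate f ▷ X ≫ (α_ e (rightDual X) X).hom ≫ e ◁ ε_ X (rightDual X)) ▷ rightDual e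
        ⊗≫ (β_ e (rightDual e)).hom ≫ ε_ e (rightDual e) := by
        rw [← evaluation_comp_braiding_evaluation he X]
        monoidal
    _ = 𝟙 _ ⊗≫ rightDual Y ◁ f ▷ rightDual e ⊗≫ (β_ (rightDual Y) e).hom ▷ Y ▷ rightDual e ⊗≫
        ((e ◁ ε_ Y (rightDual Y)) ▷ rightDual e ⊗≫
          (β_ e (rightDual e)).hom ≫ ε_ e (rightDual e)) := by
        rw [oddMate_comp_evaluation, slide]
        monoidal
    _ = 𝟙 _ ⊗≫ rightDual Y ◁ f ▷ rightDual e ⊗≫ ((β_ (rightDual Y) e).hom ▷ (Y ⊗ rightDual e) ≫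
        (e ⊗ rightDual Y) ◁ (β_ Y (rightDual e)).hom) ⊗≫
        (β_ e (rightDual Y ⊗ rightDual e)).hom ▷ Y ⊗≫
        rightDual Y ◁ ε_ e (rightDual e) ▷ Y ⊗≫ ε_ Y (rightDual Y) := by
        rw [evaluation_comp_braiding_evaluation he Y]
        monoidal
    _ = 𝟙 _ ⊗≫ rightDual Y ◁ f ▷ rightDual e ⊗≫ (rightDual Y ⊗ e) ◁ (β_ Y (rightDual e)).hom ⊗≫
        ((β_ (rightDual Y) e).hom ≫ (β_ e (rightDual Y)).hom) ▷ (rightDual e ⊗ Y) ⊗≫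
        rightDual Y ◁ ((β_ e (rightDual e)).hom ≫ ε_ e (rightDual e)) ▷ Y ⊗≫
        ε_ Y (rightDual Y) := by
        rw [← whisker_exchange, BraidedCategory.braiding_tensor_right_hom]
        monoidal
    _ = 𝟙 _ ⊗≫ rightDual Y ◁ (f ▷ rightDual e ≫ (β_ (e ⊗ Y) (rightDual e)).hom) ⊗≫
        rightDual Y ◁ ε_ e (rightDual e) ▷ Y ⊗≫ ε_ Y (rightDual Y) := by
        rw [braiding_braiding_of_mem he, BraidedCategory.braiding_tensor_left_hom]
        monoidal
    _ = _ := by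
        rw [BraidedCategory.braiding_naturality_left]
        monoidal

/-- The double dual in `C` of `f : X ⟶ e ⊗ Y`, in terms of its double dual as an odd morphism, the
Drinfeld morphism of `e` and the monoidal constraint of the double dual. -/
theorem rightAdjointMate_rightAdjointMate [RightRigidCategory C] {e : C}
    (he : symmetricCenter C e) {X Y : C} (f : X ⟶ e ⊗ Y) :
    rightAdjointMate (rightAdjointMate f) = oddMate (oddMate f) ≫
      drinfeld e ▷ rightDual (rightDual Y) ≫ tensorDoubleDual e Y := by
  apply hom_rightDual_ext
  rw [← cancel_epi (rightDual (rightDual X) ◁ (tensorDualIso e Y).hom)]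
  rw [rightAdjointMate_comp_evaluation, ← MonoidalCategory.whiskerLeft_comp_assoc,
    tensorDualIso_comp_rightAdjointMate he]
  symm
  calc _ = (oddMate (oddMate f) ≫ drinfeld e ▷ rightDual (rightDual Y)) ▷ _ ≫
        ((rightDual (rightDual e) ⊗ rightDual (rightDual Y)) ◁ (tensorDualIso e Y).hom ≫
          tensorDoubleDual e Y ▷ rightDual (e ⊗ Y) ≫
          ε_ (rightDual (e ⊗ Y)) (rightDual (rightDual (e ⊗ Y)))) := by
        rw [← whisker_exchange_assoc]
        simp only [comp_whiskerRight, Category.assoc]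
    _ = 𝟙 _ ⊗≫ oddMate (oddMate f) ▷ (rightDual Y ⊗ rightDual e) ⊗≫
        (drinfeld e ▷ ((rightDual (rightDual Y) ⊗ rightDual Y) ⊗ rightDual e) ≫
          rightDual (rightDual e) ◁
            (ε_ (rightDual Y) (rightDual (rightDual Y)) ▷ rightDual e)) ⊗≫
        ε_ (rightDual e) (rightDual (rightDual e)) := by
        rw [tensorDoubleDual_comp_evaluation]
        monoidal
    _ = 𝟙 _ ⊗≫ (oddMate (oddMate f) ▷ rightDual Y ≫ (α_ _ _ _).hom ≫
          e ◁ ε_ (rightDual Y) (rightDual (rightDual Y))) ▷ rightDual e ⊗≫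
        (drinfeld e ▷ rightDual e ≫ ε_ (rightDual e) (rightDual (rightDual e))) := by
        rw [← whisker_exchange]
        monoidal
    _ = 𝟙 _ ⊗≫ rightDual (rightDual X) ◁ oddMate f ▷ rightDual e ⊗≫
        (β_ (rightDual (rightDual X)) e).hom ▷ (rightDual X ⊗ rightDual e) ⊗≫
        ((e ◁ ε_ (rightDual X) (rightDual (rightDual X))) ▷ rightDual e ⊗≫
          (β_ e (rightDual e)).hom ≫ ε_ e (rightDual e)) := by
        rw [oddMate_comp_evaluation, drinfeld_comp_evaluation, slide]
        monoidal
    _ = 𝟙 _ ⊗≫ rightDual (rightDual X) ◁ oddMate f ▷ rightDual e ⊗≫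
        ((β_ (rightDual (rightDual X)) e).hom ≫ (β_ e (rightDual (rightDual X))).hom) ▷
          (rightDual X ⊗ rightDual e) ⊗≫
        rightDual (rightDual X) ◁ (β_ e (rightDual X ⊗ rightDual e)).hom ⊗≫
        (rightDual (rightDual X) ⊗ rightDual X) ◁ ε_ e (rightDual e) ⊗≫
        ε_ (rightDual X) (rightDual (rightDual X)) := by
        rw [whisker_comp_braiding_evaluation]
        simp only [BraidedCategory.braiding_tensor_right_hom]
        monoidal
    _ = _ := by
        rw [braiding_braiding_of_mem he]
        monoidal

end OddMate

/-! ### Pivotal structures -/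

section Pivotal

open HasRightDual

variable {C : Type u} [Category.{v} C] [MonoidalCategory C] [RightRigidCategory C]

instance {X Y : C} (f : X ⟶ Y) [IsIso f] : IsIso (rightAdjointMate f) :=
  ⟨rightAdjointMate (inv f), by rw [← comp_rightAdjointMate, IsIso.inv_hom_id, rightAdjointMate_id],
    by rw [← comp_rightAdjointMate, IsIso.hom_inv_id, rightAdjointMate_id]⟩

instance (X Y : C) : IsIso (tensorDoubleDual X Y) := by
  unfold tensorDoubleDual
  infer_instance

/-- A pivotal structure of `C` is natural for odd morphisms up to the scalar by which its component
at `e` differs from the Drinfeld morphism. -/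
theorem PivotalStructure.comp_whiskerLeft_iso {k : Type w} [Field k] [Preadditive C] [Linear k C]
    [MonoidalPreadditive C] [MonoidalLinear k C] [BraidedCategory C] (a : PivotalStructure C)
    {e : C} (he : symmetricCenter C e) {c : k} (hc : c * c = 1)
    (ha : (a.iso e).hom = c • drinfeld e) {X Y : C} (f : X ⟶ e ⊗ Y) :
    f ≫ e ◁ (a.iso Y).hom = c • ((a.iso X).hom ≫ oddMate (oddMate f)) := by
  have hd : drinfeld e = c • (a.iso e).hom := by rw [ha, smul_smul, hc, one_smul]
  have h := a.naturality f
  rw [rightAdjointMate_rightAdjointMate he, a.tensor, hd, MonoidalCategory.tensorHom_def'] at h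
  simp only [← Category.assoc, cancel_mono] at h
  rw [MonoidalLinear.smul_whiskerRight, Linear.comp_smul, ← Linear.smul_comp, cancel_mono] at h
  exact h

end Pivotal

section Mate

variable {C : Type u} [Category.{v} C] [MonoidalCategory C] [Preadditive C] [MonoidalPreadditive C]
  [BraidedCategory C] {e : C} {ξ : e ⊗ e ≅ 𝟙_ C}

namespace HatHom

/-- The composite of `SuperOps.mate`, for an even evaluation and coevaluation. -/
def mate (ξ : e ⊗ e ≅ 𝟙_ C) {X X' Y Y' : C} (ev : Y' ⊗ Y ⟶ 𝟙_ C) (coev : 𝟙_ C ⟶ X ⊗ X')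
    (f : HatHom e X Y) : HatHom e Y' X' :=
  comp ξ (of e (ρ_ Y').inv) (comp ξ (tensor ξ (of e (𝟙 Y')) (of e coev))
    (comp ξ (tensor ξ (of e (𝟙 Y')) (tensor ξ f (of e (𝟙 X'))))
      (comp ξ (of e (α_ Y' Y X').inv) (comp ξ (tensor ξ (of e ev) (of e (𝟙 X')))
        (of e (λ_ X').hom)))))

theorem mate_of {X X' Y Y' : C} (ev : Y' ⊗ Y ⟶ 𝟙_ C) (coev : 𝟙_ C ⟶ X ⊗ X') (f : X ⟶ Y) :
    mate ξ ev coev (of e f) = of e ((ρ_ Y').inv ≫ Y' ◁ coev ≫ Y' ◁ f ▷ X' ≫ (α_ Y' Y X').inv ≫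
      ev ▷ X' ≫ (λ_ X').hom) := by
  simp only [mate, of_tensor_of, of_comp_of, tensorHom_id, id_tensorHom]

theorem mate_evaluation_coevaluation {X Y : C} [HasRightDual X] [HasRightDual Y]
    (f : HatHom e X Y) :
    mate ξ (ε_ Y (HasRightDual.rightDual Y)) (η_ X (HasRightDual.rightDual X)) f =
      (rightAdjointMate f.1, oddMate f.2) := by
  ext
  · simp [mate, rightAdjointMate]
  · simp [mate, oddMate]

theorem of_evTensor (X X' Y Y' : C) [ExactPairing X X'] [ExactPairing Y Y'] :
    comp ξ (of e (α_ Y' X' (X ⊗ Y)).hom) (comp ξ (tensor ξ (of e (𝟙 Y'))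
      (comp ξ (of e (α_ X' X Y).inv) (comp ξ (tensor ξ (of e (ε_ X X')) (of e (𝟙 Y)))
        (of e (λ_ Y).hom)))) (of e (ε_ Y Y'))) = of e (ε_ (X ⊗ Y) (Y' ⊗ X')) := by
  simp only [of_tensor_of, of_comp_of, tensorHom_id, id_tensorHom, ExactPairing.tensor_evaluation]
  congr 1
  monoidal

theorem of_coevTensor (X X' Y Y' : C) [ExactPairing X X'] [ExactPairing Y Y'] :
    comp ξ (of e (η_ X X')) (comp ξ (tensor ξ (of e (𝟙 X)) (comp ξ (of e (λ_ X').inv)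
      (comp ξ (tensor ξ (of e (η_ Y Y')) (of e (𝟙 X'))) (of e (α_ Y Y' X').hom))))
        (of e (α_ X Y (Y' ⊗ X')).inv)) = of e (η_ (X ⊗ Y) (Y' ⊗ X')) := by
  simp only [of_tensor_of, of_comp_of, tensorHom_id, id_tensorHom, ExactPairing.tensor_coevaluation]
  congr 1
  monoidal

end HatHom

variable {k : Type w} [Field k] [Linear k C] [RightRigidCategory C]

open HasRightDual

theorem hatDual_map {X Y : C} (f : (hat k e ξ).Hom X Y) :
    (hatDual k e ξ).map f =
      ((rightAdjointMate f.1, oddMate f.2) : HatHom e (rightDual Y) (rightDual X)) :=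
  HatHom.mate_evaluation_coevaluation f

theorem hatDual_map_hatEven {X Y : C} (f : X ⟶ Y) :
    (hatDual k e ξ).map (hatEven k e ξ f) = hatEven k e ξ (rightAdjointMate f) :=
  HatHom.mate_of _ _ f

theorem hatDual_evTensor (X Y : C) :
    (hatDual k e ξ).evTensor X Y = hatEven k e ξ (ε_ (X ⊗ Y) (rightDual Y ⊗ rightDual X)) :=
  HatHom.of_evTensor X (rightDual X) Y (rightDual Y)

theorem hatDual_coevTensor (X Y : C) :
    (hatDual k e ξ).coevTensor X Y = hatEven k e ξ (η_ (X ⊗ Y) (rightDual Y ⊗ rightDual X)) :=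
  HatHom.of_coevTensor X (rightDual X) Y (rightDual Y)

theorem hatDual_tensorDual (X Y : C) :
    (hatDual k e ξ).tensorDual X Y = hatEven k e ξ (tensorDualIso X Y).hom := by
  unfold SuperOps.DualOps.tensorDual
  rw [hatDual_evTensor]
  exact HatHom.mate_of _ _ (𝟙 (X ⊗ Y))

theorem hatDual_tensorDualInv (X Y : C) :
    (hatDual k e ξ).tensorDualInv X Y = hatEven k e ξ (tensorDualIso X Y).inv := by
  unfold SuperOps.DualOps.tensorDualInv
  rw [hatDual_coevTensor]
  exact HatHom.mate_of _ _ (𝟙 (X ⊗ Y))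

theorem hatDual_tensorDoubleDual (X Y : C) :
    (hatDual k e ξ).tensorDoubleDual X Y = hatEven k e ξ (tensorDoubleDual X Y) :=
  (congrArg₂ (hat k e ξ).comp (hatDual_tensorDual (rightDual Y) (rightDual X))
    ((congrArg (hatDual k e ξ).map (hatDual_tensorDualInv X Y)).trans
      (hatDual_map_hatEven _))).trans (HatHom.of_comp_of _ _)

/-- If `a_e = (-1)^s u_e`, then `a` is natural for `f ↦ (-1)^(s|f|) f**`. -/
theorem hatDual_isTwistedPivotal [MonoidalLinear k C] (he : symmetricCenter C e)
    (a : PivotalStructure C) (s : ZMod 2)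
    (ha : (a.iso e).hom = SuperOps.sign k s 1 • drinfeld e) :
    (hatDual k e ξ).IsTwistedPivotal s (fun X => hatEven k e ξ (a.iso X).hom) where
  iso X := ⟨_, hat_isEvenInverse (a.iso X)⟩
  naturality {X Y} i f hf := by
    rw [hatDual_map, hatDual_map]
    change HatHom e X Y at f
    change HatHom.comp ξ f (HatHom.of e _) = HatHom.comp ξ (HatHom.of e _) (SuperOps.sign k s i •
      ((rightAdjointMate (rightAdjointMate f.1), oddMate (oddMate f.2)) : HatHom e _ _))
    have hc : SuperOps.sign k s 1 * SuperOps.sign k s 1 = 1 := by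
      obtain rfl | rfl := ZMod.two_eq_zero_or_one s <;> simp
    obtain rfl | rfl := ZMod.two_eq_zero_or_one i
    · have h : f.2 = 0 := HatHom.mem_parity_zero.1 hf
      ext
      · simp [h, a.naturality]
      · simp [h, oddMate]
    · have h : f.1 = 0 := HatHom.mem_parity_one.1 hf
      ext
      · simp [h, rightAdjointMate]
      · simp [h, a.comp_whiskerLeft_iso he hc ha]
  tensor X Y := by
    have h : HatHom.of e (a.iso (X ⊗ Y)).hom =
        HatHom.comp ξ (HatHom.tensor ξ (HatHom.of e (a.iso X).hom) (HatHom.of e (a.iso Y).hom))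
          (HatHom.of e (tensorDoubleDual X Y)) := by
      rw [HatHom.of_tensor_of, HatHom.of_comp_of, ← a.tensor]
    rw [hatDual_tensorDoubleDual]
    exact h

end Mate

theorem mainTheorem11 {k : Type w} [Field k] [IsAlgClosed k] [CharZero k]
    {C : Type u} [Category.{v} C] [Abelian C] [Linear k C] [MonoidalCategory C]
    [MonoidalPreadditive C] [MonoidalLinear k C] [BraidedCategory C] [RigidCategory C]
    (hfus : IsFusionCategory k C) (hdeg : IsSlightlyDegenerate k C) (a : PivotalStructure C)
    (e : C) (he : symmetricCenter C e) (hsimple : Simple e) (hunit : IsEmpty (e ≅ 𝟙_ C))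
    (ξ : e ⊗ e ≅ 𝟙_ C) :
    (hat k e ξ).IsMonoidalSupercategory ∧
    (hat k e ξ).IsBraiding (fun X Y => hatEven k e ξ (β_ X Y).hom) ∧
    (hat k e ξ).IsRigid (hatDual k e ξ) ∧
    ((a.iso e).hom = drinfeld e →
      (hatDual k e ξ).IsPivotal (fun X => hatEven k e ξ (a.iso X).hom)) ∧
    ((a.iso e).hom = -drinfeld e →
      (hatDual k e ξ).IsSuperpivotal (fun X => hatEven k e ξ (a.iso X).hom)) := by
  have hβ := hdeg.braiding_self he hunit ξ
  exact ⟨hat_isMonoidalSupercategory hfus.finite_hom hβ, hat_isBraiding he hβ, hat_isRigid,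
    fun h => hatDual_isTwistedPivotal he a 0 (by simpa using h),
    fun h => hatDual_isTwistedPivotal he a 1 (by simpa using h)⟩
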